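/- Let $d\ge 0$, let $\mathcal A\subset\mathbb Z^d$ be a finite set that is primitive (it affinely spans $\mathbb Z^d$ over $\mathbb Z$), let $w=(w_{\mathbf a})_{\mathbf a\in\mathcal A}$ be positive real weights, and let $\Delta\subset\mathbb R^d$ be the convex hull of $\mathcal A$. A \emph{patch} indexed by $\mathcal A$ is a family $\beta=(\beta_{\mathbf a})_{\mathbf a\in\mathcal A}$ of continuous functions $\beta_{\mathbf a}\colon\Delta\to\mathbb R_{\ge 0}$ without common zero; its normalized blending functions are $\hat\beta_{\mathbf a}=\beta_{\mathbf a}/\sum_{\mathbf b}\beta_{\mathbf b}$ and its tautological map is $\tau(x)=\sum_{\mathbf a}\hat\beta_{\mathbf a}(x)\,\mathbf a$. The patch is \emph{proper} if $\tau$ is a homeomorphism $\Delta\to\Delta$. It has \emph{rational linear precision} if it is proper and there is a homeomorphism $\psi\colon\Delta\to\Delta$ such that the functions $\hat\beta_{\mathbf a}\circ\psi$ are rational functions (quotients of real polynomials, where the denominator does not vanish) and have linear precision: $\Lambda(x)=\sum_{\mathbf a}\hat\beta_{\mathbf a}(\psi(x))\,\Lambda(\mathbf a)$ for all $x\in\Delta$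 and all affine functions $\Lambda\colon\mathbb R^d\to\mathbb R$. The patch is a \emph{toric patch of shape $(\mathcal A,w)$} if the image of $x\mapsto[\beta_{\mathbf a}(x)\mid\mathbf a\in\mathcal A]$, $\Delta\to\mathbb{RP}^{\mathcal A}$, equals the closure $X_{\mathcal A,w}$ of $\{[w_{\mathbf a}x^{\mathbf a}\mid\mathbf a\in\mathcal A] : x\in\mathbb R_{>0}^d\}$. Let $f_{\mathcal A,w}=\sum_{\mathbf a\in\mathcal A}w_{\mathbf a}x^{\mathbf a}$, let $N$ be a nonzero integer, and let $F=\sum_{\mathbf a\in\mathcal A}w_{\mathbf a}\,x_0^{N-|\mathbf a|}x^{\mathbf a}$, where $|\mathbf a|=a_1+\dots+a_d$, be the homogenization of $f_{\mathcal A,w}$ of degree $N$ (if $\mathcal A\subset\mathbb N^d$ and $d\ge1$, then $N=\deg f_{\mathcal A,w}$ gives the usual homogenization). Consider the rational map $$D_{\mathrm{torus}}F=\Bigl[x_0\tfrac{\partial F}{\partial x_0}:x_1\tfrac{\partial F}{\partial x_1}:\dots:x_d\tfrac{\partial F}{\partial x_d}\Bigr]\colon\mathbb{CP}^d\dashrightarrow\mathbb{CP}^d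 .$$ (1) There is a toric patch of shape $(\mathcal A,w)$ with rational linear precision if and only if $D_{\mathrm{torus}}F$ is a birational isomorphism. (2) For every toric patch $\beta$ of shape $(\mathcal A,w)$ whose parametrization $\Delta\to X_{\mathcal A,w}$ is injective, $\beta$ has rational linear precision if and only if $D_{\mathrm{torus}}F$ is a birational isomorphism. -/

import Mathlib

open scoped LinearAlgebra.Projectivization

namespace ToricPatch

noncomputable section

/-! ### Parametric patches -/

section Patches

variable {d : ℕ} {ι : Type*}

/-- The domain polytope `Δ`: the convex hull of the points `pt a` that index the patch. -/
def domainPolytope (pt : ι → Fin d → ℝ) : Set (Fin d → ℝ) :=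
  convexHull ℝ (Set.range pt)

/-- A parametric patch: non-negative continuous blending functions on `Δ`, indexed by the points
`pt a`, without a common zero.  (Only continuity is asked for, because a reparametrization by a
homeomorphism of `Δ` is again a patch; patches with smooth blending functions are included.) -/
structure Patch (pt : ι → Fin d → ℝ) where
  /-- the blending functions -/
  blend : ι → domainPolytope pt → ℝ
  continuous_blend : ∀ a, Continuous (blend a)
  nonneg : ∀ a x, 0 ≤ blend a x
  no_base_point : ∀ x, (fun a => blend a x) ≠ 0

namespace Patch

variable {pt : ι → Fin d → ℝ}

/-- The map `β : Δ → ℝℙ^𝒜`, `x ↦ [β_a(x)]`. -/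
def toProj (β : Patch pt) (x : domainPolytope pt) : ℙ ℝ (ι → ℝ) :=
  Projectivization.mk ℝ (fun a => β.blend a x) (β.no_base_point x)

/-- The image `X_β` of `Δ` in `ℝℙ^𝒜`. -/
def image (β : Patch pt) : Set (ℙ ℝ (ι → ℝ)) := Set.range β.toProj

variable [Fintype ι]

/-- The normalized blending functions `β_a / ∑ β_b`. -/
def normalized (β : Patch pt) (a : ι) (x : domainPolytope pt) : ℝ :=
  β.blend a x / ∑ b, β.blend b x

/-- The tautological map `τ(x) = (∑ β_a(x) a) / (∑ β_a(x))`. -/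
def tautological (β : Patch pt) (x : domainPolytope pt) : Fin d → ℝ :=
  ∑ a, β.normalized a x • pt a

/-- A patch is proper if its tautological map is a homeomorphism of `Δ`. -/
def IsProper (β : Patch pt) : Prop :=
  ∃ h : domainPolytope pt ≃ₜ domainPolytope pt, ∀ x, (h x : Fin d → ℝ) = β.tautological x

end Patch

/-- Functions `b a` on `Δ` have linear precision if they replicate every affine function. -/
def HasLinearPrecision [Fintype ι] (pt : ι → Fin d → ℝ) (b : ι → domainPolytope pt → ℝ) : Prop :=
  ∀ (Λ : (Fin d → ℝ) →ᵃ[ℝ] ℝ) (x : domainPolytope pt), Λ x = ∑ a, b a x * Λ (pt a)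

/-- A function on a subset `S` of `ℝ^d` is a rational function if it is a quotient `p / q` of two
polynomials, `q ≠ 0`, at the points of `S` where `q` does not vanish.  (For a continuous function
on a full dimensional polytope this determines the function.) -/
def IsRationalFunction {S : Set (Fin d → ℝ)} (g : S → ℝ) : Prop :=
  ∃ p q : MvPolynomial (Fin d) ℝ, q ≠ 0 ∧
    ∀ x : S, MvPolynomial.eval (x : Fin d → ℝ) q ≠ 0 →
      g x = MvPolynomial.eval (x : Fin d → ℝ) p / MvPolynomial.eval (x : Fin d → ℝ) q

/-- Rational linear precision: the patch is proper, and its reparametrization by a homeomorphism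
of `Δ` which has linear precision has rational (normalized) blending functions. -/
def Patch.HasRationalLinearPrecision [Fintype ι] {pt : ι → Fin d → ℝ} (β : Patch pt) : Prop :=
  β.IsProper ∧
    ∃ ψ : domainPolytope pt ≃ₜ domainPolytope pt,
      HasLinearPrecision pt (fun a x => β.normalized a (ψ x)) ∧
        ∀ a, IsRationalFunction (fun x => β.normalized a (ψ x))

end Patches

/-! ### Toric patches -/

section Toric

variable {d : ℕ}

/-- The points of `𝒜 ⊂ ℤ^d`, regarded as points of `ℝ^d`. -/
def latticePoint (A : Finset (Fin d → ℤ)) (a : A) : Fin d → ℝ := fun i => ((a : Fin d → ℤ) i : ℝ)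

/-- The usual topology of a real projective space: the quotient topology from the nonzero
vectors. -/
abbrev projTopology (κ : Type*) : TopologicalSpace (ℙ ℝ (κ → ℝ)) :=
  TopologicalSpace.coinduced
    (fun v : {v : κ → ℝ // v ≠ 0} => Projectivization.mk ℝ (v : κ → ℝ) v.2) inferInstance

/-- The set `φ_{𝒜,w}(ℝ_>^d)` of all points `[w_a x^a | a ∈ 𝒜]` with `x` positive. -/
def positivePart (A : Finset (Fin d → ℤ)) (w : A → ℝ) : Set (ℙ ℝ (A → ℝ)) :=
  {P | ∃ x : Fin d → ℝ, (∀ i, 0 < x i) ∧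
    ∃ h : (fun a : A => w a * ∏ i, x i ^ (a : Fin d → ℤ) i) ≠ 0, P = Projectivization.mk ℝ _ h}

/-- `X_{𝒜,w}`, the closure of `φ_{𝒜,w}(ℝ_>^d)` in `ℝℙ^𝒜`. -/
def nonnegPart (A : Finset (Fin d → ℤ)) (w : A → ℝ) : Set (ℙ ℝ (A → ℝ)) :=
  @closure _ (projTopology A) (positivePart A w)

/-- A toric patch of shape `(𝒜, w)`: a patch indexed by `𝒜` with `X_β = X_{𝒜,w}`. -/
def IsToricPatch (A : Finset (Fin d → ℤ)) (w : A → ℝ) (β : Patch (latticePoint A)) : Prop :=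
  β.image = nonnegPart A w

/-- `𝒜` is primitive if it affinely spans `ℤ^d`.  (So `𝒜` is not empty and `Δ` has
dimension `d`.) -/
def IsPrimitive (A : Finset (Fin d → ℤ)) : Prop :=
  affineSpan ℤ (A : Set (Fin d → ℤ)) = ⊤

end Toric

/-! ### Laurent polynomials and the toric differential -/

section LaurentPolynomials

/-- Complex Laurent polynomials in the variables `x i`, `i : σ`. -/
abbrev Laurent (σ : Type*) : Type _ := AddMonoidAlgebra ℂ (σ → ℤ)

/-- The monomial `c * x^a`. -/
def Laurent.monomial {σ : Type*} (a : σ → ℤ) (c : ℂ) : Laurent σ := AddMonoidAlgebra.single a c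

/-- The variable `x i`. -/
def Laurent.X {σ : Type*} [DecidableEq σ] (i : σ) : Laurent σ := Laurent.monomial (Pi.single i 1) 1

/-- The partial derivative `∂/∂x_i`. -/
def Laurent.pderiv {σ : Type*} [DecidableEq σ] (i : σ) (f : Laurent σ) : Laurent σ :=
  f.coeff.sum fun a c => Laurent.monomial (a - Pi.single i 1) ((a i : ℂ) * c)

/-- A polynomial, regarded as a Laurent polynomial. -/
def toLaurent {σ : Type*} [DecidableEq σ] : MvPolynomial σ ℂ →ₐ[ℂ] Laurent σ :=
  MvPolynomial.aeval Laurent.X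

variable {d : ℕ}

/-- The Laurent polynomial `f_{𝒜,w} = ∑ w_a x^a`. -/
def shapePolynomial (A : Finset (Fin d → ℤ)) (w : A → ℝ) : Laurent (Fin d) :=
  ∑ a : A, Laurent.monomial (a : Fin d → ℤ) (w a : ℂ)

/-- The homogenization of degree `N` of a Laurent polynomial with respect to a new variable `x_0`:
the monomial `x^a` becomes `x_0^(N - |a|) x^a`.  (For a polynomial `f` and `N = deg f` this is
the usual homogenization.) -/
def homogenize (N : ℤ) (f : Laurent (Fin d)) : Laurent (Fin (d + 1)) :=
  f.coeff.sum fun a c => Laurent.monomial (Fin.cons (N - ∑ i, a i) a : Fin (d + 1) → ℤ) c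

/-- The toric differential of `F`: the tuple of the toric derivatives `x_i ∂F/∂x_i`. -/
def toricDifferential {n : ℕ} (F : Laurent (Fin n)) : Fin n → Laurent (Fin n) :=
  fun i => Laurent.X i * Laurent.pderiv i F

end LaurentPolynomials

/-! ### Rational maps of complex projective spaces -/

/-- A (presentation of a) rational map `ℂℙ^n ⇢ ℂℙ^m`: an `(m+1)`-tuple of homogeneous polynomials
of the same degree, not all zero. -/
structure RationalMap (n m : ℕ) where
  /-- the common degree -/
  degree : ℕ
  /-- the homogeneous coordinates of the map -/
  coord : Fin (m + 1) → MvPolynomial (Fin (n + 1)) ℂ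
  isHomogeneous : ∀ i, (coord i).IsHomogeneous degree
  coord_ne_zero : coord ≠ 0

namespace RationalMap

variable {n m : ℕ}

/-- The values of the homogeneous coordinates at a vector. -/
def evalVec (φ : RationalMap n m) (v : Fin (n + 1) → ℂ) : Fin (m + 1) → ℂ :=
  fun i => MvPolynomial.eval v (φ.coord i)

/-- The partial function `ℂℙ^n → ℂℙ^m`, defined where the coordinates do not all vanish.  By
homogeneity it does not depend on the chosen representatives of points, see `mk_mem_toPart`. -/
def toPart (φ : RationalMap n m) :
    ℙ ℂ (Fin (n + 1) → ℂ) → Part (ℙ ℂ (Fin (m + 1) → ℂ)) :=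
  fun P => ⟨φ.evalVec P.rep ≠ 0, fun h => Projectivization.mk ℂ (φ.evalVec P.rep) h⟩

theorem evalVec_smul (φ : RationalMap n m) (c : ℂ) (v : Fin (n + 1) → ℂ) :
    φ.evalVec (c • v) = c ^ φ.degree • φ.evalVec v := by
  funext i
  simp only [evalVec, Pi.smul_apply, smul_eq_mul, MvPolynomial.eval_eq', Finset.mul_sum]
  refine Finset.sum_congr rfl fun e he => ?_
  have hdeg : ∑ j, e j = φ.degree := by
    have := φ.isHomogeneous i (MvPolynomial.mem_support_iff.1 he)
    rwa [Finsupp.weight_apply, Finsupp.sum_fintype _ _ (by simp),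
      Finset.sum_congr rfl (fun j _ => by simp : ∀ j ∈ Finset.univ, e j • (1 : Fin (n + 1) → ℕ) j
        = e j)] at this
  simp only [mul_pow, Finset.prod_mul_distrib, Finset.prod_pow_eq_pow_sum, hdeg]
  ring

theorem mk_mem_toPart (φ : RationalMap n m) (v : Fin (n + 1) → ℂ) (hv : v ≠ 0)
    (h : φ.evalVec v ≠ 0) :
    Projectivization.mk ℂ (φ.evalVec v) h ∈ φ.toPart (Projectivization.mk ℂ v hv) := by
  obtain ⟨c, hc⟩ := Projectivization.exists_smul_eq_mk_rep ℂ v hv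
  have key : φ.evalVec (Projectivization.mk ℂ v hv).rep = (c : ℂ) ^ φ.degree • φ.evalVec v := by
    rw [← hc]
    exact φ.evalVec_smul (c : ℂ) v
  have hne : (c : ℂ) ^ φ.degree ≠ 0 := pow_ne_zero _ c.ne_zero
  have hrep : φ.evalVec (Projectivization.mk ℂ v hv).rep ≠ 0 := by
    rw [key]
    exact smul_ne_zero hne h
  exact ⟨hrep, (Projectivization.mk_eq_mk_iff' ℂ _ _ hrep h).2 ⟨(c : ℂ) ^ φ.degree, key.symm⟩⟩

/-- The composite `ψ ∘ φ` is defined somewhere, and it is the identity where it is defined. -/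
def IsLeftInverse (ψ : RationalMap m n) (φ : RationalMap n m) : Prop :=
  (∃ P Q R, Q ∈ φ.toPart P ∧ R ∈ ψ.toPart Q) ∧
    ∀ P Q R, Q ∈ φ.toPart P → R ∈ ψ.toPart Q → R = P

/-- A rational map is a birational isomorphism if it has an inverse rational map. -/
def IsBirational (φ : RationalMap n m) : Prop :=
  ∃ ψ : RationalMap m n, ψ.IsLeftInverse φ ∧ φ.IsLeftInverse ψ

/-- The rational map `φ` is the one given by the formula `[G_0 : … : G_m]`, where the `G_i` are
Laurent polynomials: clearing denominators by a monomial turns the `G_i` into the coordinates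
of `φ`. -/
def IsGivenBy (φ : RationalMap n m) (G : Fin (m + 1) → Laurent (Fin (n + 1))) : Prop :=
  ∃ e : Fin (n + 1) → ℤ, ∀ i, toLaurent (φ.coord i) = Laurent.monomial e 1 * G i

end RationalMap

/-- Laurent polynomials `G_0, …, G_m` define a birational isomorphism
`[G_0 : … : G_m] : ℂℙ^n ⇢ ℂℙ^m`. -/
def DefinesBirational {n m : ℕ} (G : Fin (m + 1) → Laurent (Fin (n + 1))) : Prop :=
  ∃ φ : RationalMap n m, φ.IsGivenBy G ∧ φ.IsBirational

end

end ToricPatch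

/-! Both sides of each equivalence amount to `HasRationalInverse w`: the torus coordinates `x` are
rational functions of the moment `y = ∑ w_a x^a a / ∑ w_a x^a`.

The bridge on the patch side is Birch's theorem. Scale the points of `X_{𝒜,w}` to coordinate sum
one; then `z ↦ ∑ z_a a` maps them bijectively onto `Δ` (`moment_injOn`, `moment_surjOn`), and
compactness makes this a homeomorphism. Linear precision of a reparametrized toric patch says that
its normalized blending functions at `y` have moment `y`, so they are the coordinates of the unique
point of `X_{𝒜,w}` over `y`. Over the interior of `Δ` this point is `w_a x^a / ∑ w_b x^b`, hence
rational in `y` as soon as `x` is. Conversely, since `𝒜` is primitive, each `x_i` is a Laurent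
monomial in the numbers `z_a / w_a`, hence rational in `y` if the blending functions are.

On the other side, Euler's relation puts `D_torus F` in the chart where the coordinates sum to `N`:
at a positive vector `v` with `x_i = v_i / v_0`, its value is a nonzero multiple of `(N - ∑ y_i, y)`
(`exists_eval_eq_smul_liftPoint`). Thus `D_torus F` is the moment map in homogeneous coordinates.
Polynomial identities may be tested on real open sets, so a rational inverse of one map yields a
rational inverse of the other (`hasRationalInverse_of_isBirational`,
`definesBirational_of_hasRationalInverse`). -/

open scoped LinearAlgebra.Projectivization Topology

namespace ToricPatch

noncomputable section

/-! ### Birch's theorem for the moment map on the non-negative part. -/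

section Birch

variable {d : ℕ} {A : Finset (Fin d → ℤ)}

/-- The vector `(w_a x^a)` of homogeneous coordinates. -/
def monomialVec (w : A → ℝ) (x : Fin d → ℝ) (a : A) : ℝ :=
  w a * ∏ i, x i ^ (a : Fin d → ℤ) i

/-- The vector `(w_a x^a)`, scaled to have coordinate sum one. -/
def torusPoint (w : A → ℝ) (x : Fin d → ℝ) (a : A) : ℝ :=
  monomialVec w x a / ∑ b, monomialVec w x b

/-- The linear map `z ↦ ∑ z_a a`. -/
def moment (z : A → ℝ) : Fin d → ℝ := ∑ a, z a • latticePoint A a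

/-- The closure of the normalized positive points, in affine space. -/
def normalizedPart (w : A → ℝ) : Set (A → ℝ) :=
  closure (torusPoint w '' {x | ∀ i, 0 < x i})

variable {w : A → ℝ}

theorem moment_apply (z : A → ℝ) (i : Fin d) :
    moment z i = ∑ a, z a * ((a : Fin d → ℤ) i : ℝ) := by
  simp [moment, latticePoint]

theorem continuous_moment : Continuous (moment : (A → ℝ) → Fin d → ℝ) := by
  unfold moment
  fun_prop

theorem IsPrimitive.nonempty (hA : IsPrimitive A) : Nonempty A := by
  rcases A.eq_empty_or_nonempty with rfl | h
  · simp [IsPrimitive] at hA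
  · exact h.to_subtype

/-- The unit vectors are combinations of points of a primitive set with coefficient sum zero. -/
theorem IsPrimitive.exists_weights (hA : IsPrimitive A) (v : Fin d → ℤ) :
    ∃ m : A → ℤ, ∑ a, m a = 0 ∧ ∑ a, m a • (a : Fin d → ℤ) = v := by
  classical
  have hv : v ∈ vectorSpan ℤ (A : Set (Fin d → ℤ)) := by
    rw [← direction_affineSpan, hA, AffineSubspace.direction_top]
    trivial
  rw [vectorSpan] at hv
  induction hv using Submodule.span_induction with
  | mem x hx =>
    obtain ⟨a, ha, b, hb, rfl⟩ := Set.mem_vsub.1 hx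
    refine ⟨Pi.single ⟨a, ha⟩ 1 - Pi.single ⟨b, hb⟩ 1, by simp, ?_⟩
    simp [sub_smul, Finset.sum_sub_distrib, Pi.single_apply, ite_smul]
  | zero => exact ⟨0, by simp, by simp⟩
  | add x y _ _ hx hy =>
    obtain ⟨m, hm, rfl⟩ := hx
    obtain ⟨n, hn, rfl⟩ := hy
    exact ⟨m + n, by simp only [Pi.add_apply, Finset.sum_add_distrib, hm, hn, add_zero],
      by simp [add_smul, Finset.sum_add_distrib]⟩
  | smul c x _ hx =>
    obtain ⟨m, hm, rfl⟩ := hx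
    exact ⟨c • m, by simp only [Pi.smul_apply, smul_eq_mul, ← Finset.mul_sum, hm, mul_zero], by simp [mul_smul, Finset.smul_sum]⟩

/-- Integer weights of sum zero that produce a unit vector are also real weights, so the direction
space contains the standard basis. This is what gives `Δ` a nonempty interior. -/
theorem IsPrimitive.affineSpan_latticePoint (hA : IsPrimitive A) :
    affineSpan ℝ (Set.range (latticePoint A)) = ⊤ := by
  classical
  have := hA.nonempty
  rw [AffineSubspace.affineSpan_eq_top_iff_vectorSpan_eq_top_of_nonempty ℝ _ _
    (Set.range_nonempty _), eq_top_iff, ← (Pi.basisFun ℝ (Fin d)).span_eq, Submodule.span_le]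
  rintro _ ⟨i, rfl⟩
  obtain ⟨m, hm, hmi⟩ := hA.exists_weights (Pi.single i 1)
  have hs : ∑ a, (m a : ℝ) = 0 := by exact_mod_cast hm
  have key := weightedVSub_mem_vectorSpan (s := Finset.univ) hs (latticePoint A)
  rw [Finset.weightedVSub_eq_linear_combination _ hs] at key
  rw [SetLike.mem_coe]
  convert key
  funext j
  have := congrFun hmi j
  simp only [Finset.sum_apply, Pi.smul_apply, smul_eq_mul] at this
  simp only [Pi.basisFun_apply, Finset.sum_apply, Pi.smul_apply, latticePoint, smul_eq_mul]
  rw [show (Pi.single i (1 : ℝ) : Fin d → ℝ) j = ((Pi.single i (1 : ℤ) : Fin d → ℤ) j : ℝ) by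
    simp [Pi.single_apply], ← this]
  push_cast
  rfl

theorem convex_domainPolytope : Convex ℝ (domainPolytope (latticePoint A)) :=
  convex_convexHull ℝ _

theorem isCompact_domainPolytope : IsCompact (domainPolytope (latticePoint A)) :=
  (Set.finite_range _).isCompact_convexHull (𝕜 := ℝ)

theorem IsPrimitive.interior_nonempty (hA : IsPrimitive A) :
    (interior (domainPolytope (latticePoint A))).Nonempty :=
  interior_convexHull_nonempty_iff_affineSpan_eq_top.2 hA.affineSpan_latticePoint

theorem IsPrimitive.closure_interior (hA : IsPrimitive A) :
    closure (interior (domainPolytope (latticePoint A))) = domainPolytope (latticePoint A) := by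
  rw [convex_domainPolytope.closure_interior_eq_closure_of_nonempty_interior hA.interior_nonempty,
    isCompact_domainPolytope.isClosed.closure_eq]

theorem monomialVec_pos (hw : ∀ a, 0 < w a) {x : Fin d → ℝ} (hx : ∀ i, 0 < x i) (a : A) :
    0 < monomialVec w x a :=
  mul_pos (hw a) (Finset.prod_pos fun i _ => zpow_pos (hx i) _)

theorem sum_monomialVec_pos [Nonempty A] (hw : ∀ a, 0 < w a) {x : Fin d → ℝ}
    (hx : ∀ i, 0 < x i) : 0 < ∑ a, monomialVec w x a :=
  Finset.sum_pos (fun a _ => monomialVec_pos hw hx a) Finset.univ_nonempty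

theorem torusPoint_pos (hA : Nonempty A) (hw : ∀ a, 0 < w a) {x : Fin d → ℝ}
    (hx : ∀ i, 0 < x i) (a : A) : 0 < torusPoint w x a :=
  div_pos (monomialVec_pos hw hx a) (sum_monomialVec_pos hw hx)

theorem sum_torusPoint (hA : Nonempty A) (hw : ∀ a, 0 < w a) {x : Fin d → ℝ}
    (hx : ∀ i, 0 < x i) : ∑ a, torusPoint w x a = 1 := by
  simp only [torusPoint, ← Finset.sum_div]
  exact div_self (sum_monomialVec_pos hw hx).ne'

theorem torusPoint_mem (x : Fin d → ℝ) (hx : ∀ i, 0 < x i) :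
    torusPoint w x ∈ normalizedPart w :=
  subset_closure ⟨x, hx, rfl⟩

theorem normalizedPart_subset_stdSimplex (hA : Nonempty A) (hw : ∀ a, 0 < w a) :
    normalizedPart w ⊆ stdSimplex ℝ A := by
  refine closure_minimal ?_ (isClosed_stdSimplex ℝ A)
  rintro _ ⟨x, hx, rfl⟩
  exact ⟨fun a => (torusPoint_pos hA hw hx a).le, sum_torusPoint hA hw hx⟩

theorem isCompact_normalizedPart (hA : Nonempty A) (hw : ∀ a, 0 < w a) :
    IsCompact (normalizedPart w) :=
  (isCompact_stdSimplex ℝ A).of_isClosed_subset isClosed_closure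
    (normalizedPart_subset_stdSimplex hA hw)

theorem moment_mem_domainPolytope {z : A → ℝ} (hz : z ∈ stdSimplex ℝ A) :
    moment z ∈ domainPolytope (latticePoint A) :=
  (convex_domainPolytope (A := A)).sum_mem (fun a _ => hz.1 a) hz.2
    fun a _ => subset_convexHull ℝ _ ⟨a, rfl⟩

/-- The logarithm of `z_a / w_a` is an affine function of `a`. Pairing it with weights therefore
sees only their sum and their moment. -/
theorem torusPoint_div (hw : ∀ a, 0 < w a) (hA : Nonempty A) {x : Fin d → ℝ}
    (hx : ∀ i, 0 < x i) (a : A) :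
    torusPoint w x a / w a =
      Real.exp (∑ i, Real.log (x i) * ((a : Fin d → ℤ) i : ℝ)
        - Real.log (∑ b, monomialVec w x b)) := by
  have h : ∏ i, x i ^ (a : Fin d → ℤ) i
      = Real.exp (∑ i, Real.log (x i) * ((a : Fin d → ℤ) i : ℝ)) := by
    rw [Real.exp_sum]
    exact Finset.prod_congr rfl fun i _ => by
      rw [← Real.rpow_def_of_pos (hx i), Real.rpow_intCast]
  have := (hw a).ne'
  rw [Real.exp_sub, Real.exp_log (sum_monomialVec_pos hw hx), ← h, torusPoint, monomialVec]
  field_simp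

/-- Binomial relations with real exponents hold on the closure of the positive points. -/
theorem prod_rpow_eq_of_moment_eq (hA : Nonempty A) (hw : ∀ a, 0 < w a) {u v ζ : A → ℝ}
    (hu : u ∈ stdSimplex ℝ A) (hv : v ∈ stdSimplex ℝ A) (huv : moment u = moment v)
    (hζ : ζ ∈ normalizedPart w) :
    ∏ a, (ζ a / w a) ^ u a = ∏ a, (ζ a / w a) ^ v a := by
  -- Exponents from the simplex are non-negative, so the real powers stay continuous where
  -- coordinates vanish.
  have hcont : ∀ u ∈ stdSimplex ℝ A, Continuous fun ζ : A → ℝ => ∏ a, (ζ a / w a) ^ u a :=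
    fun u hu => continuous_finsetProd _ fun a _ =>
      (Real.continuous_rpow_const (hu.1 a)).comp ((continuous_apply a).div_const _)
  have hclosed := isClosed_eq (hcont u hu) (hcont v hv)
  refine closure_minimal ?_ hclosed hζ
  rintro _ ⟨x, hx, rfl⟩
  have key : ∀ u ∈ stdSimplex ℝ A, ∏ a, (torusPoint w x a / w a) ^ u a =
      Real.exp (∑ i, Real.log (x i) * moment u i - Real.log (∑ b, monomialVec w x b)) := by
    intro u hu
    simp only [torusPoint_div hw hA hx, ← Real.exp_mul, ← Real.exp_sum, sub_mul,
      Finset.sum_sub_distrib, ← Finset.mul_sum, hu.2, mul_one, moment_apply, Finset.sum_mul]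
    rw [Finset.sum_comm]
    simp only [Finset.mul_sum]
    congr 2
    exact Finset.sum_congr rfl fun i _ => Finset.sum_congr rfl fun a _ => by ring
  simp only [Set.mem_ofPred_eq]
  rw [key u hu, key v hv, huv]

/-- Apply the binomial relation at `z` with exponents `z` and `z'`. The product with exponents `z`
is never zero, because `0 ^ 0 = 1`; the one with exponents `z'` would be zero if `z a = 0` and `z' a
≠ 0`. -/
theorem support_subset_of_moment_eq (hA : Nonempty A) (hw : ∀ a, 0 < w a) {z z' : A → ℝ}
    (hz : z ∈ normalizedPart w) (hz' : z' ∈ normalizedPart w) (h : moment z = moment z')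
    {a : A} (ha : z a = 0) : z' a = 0 := by
  have hs := normalizedPart_subset_stdSimplex hA hw hz
  have hs' := normalizedPart_subset_stdSimplex hA hw hz'
  by_contra hne
  have key := prod_rpow_eq_of_moment_eq hA hw hs hs' h hz
  rw [Finset.prod_eq_zero (i := a) (f := fun a => (z a / w a) ^ z' a) (Finset.mem_univ a)
    (by simp [ha, Real.zero_rpow hne])] at key
  obtain ⟨b, -, hb⟩ := Finset.prod_eq_zero_iff.1 key
  rcases (hs.1 b).eq_or_lt with h0 | hpos
  · simp [← h0] at hb
  · exact (Real.rpow_pos_of_pos (div_pos hpos (hw b)) _).ne' hb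

/-- This is the logarithm of the binomial relation. Vanishing coordinates carry exponent zero, so
they contribute the factor `1` and the summand `0`. -/
theorem sum_mul_log_eq_of_moment_eq (hA : Nonempty A) (hw : ∀ a, 0 < w a) {u v z : A → ℝ}
    (hu : u ∈ stdSimplex ℝ A) (hv : v ∈ stdSimplex ℝ A) (huv : moment u = moment v)
    (hz : z ∈ normalizedPart w) (hzu : ∀ a, z a = 0 → u a = 0) (hzv : ∀ a, z a = 0 → v a = 0) :
    ∑ a, u a * Real.log (z a / w a) = ∑ a, v a * Real.log (z a / w a) := by
  have hs := normalizedPart_subset_stdSimplex hA hw hz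
  have hlog : ∀ u : A → ℝ, (∀ a, z a = 0 → u a = 0) →
      Real.log (∏ a, (z a / w a) ^ u a) = ∑ a, u a * Real.log (z a / w a) := by
    intro u hzu
    have hpos : ∀ a, 0 < z a ∨ u a = 0 := fun a =>
      (hs.1 a).eq_or_lt.elim (fun h => .inr (hzu a h.symm)) .inl
    rw [Real.log_prod]
    · refine Finset.sum_congr rfl fun a _ => ?_
      rcases hpos a with h | h
      · exact Real.log_rpow (div_pos h (hw a)) _
      · simp [h]
    · intro a _
      rcases hpos a with h | h
      · exact (Real.rpow_pos_of_pos (div_pos h (hw a)) _).ne'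
      · simp [h]
  rw [← hlog u hzu, ← hlog v hzv, prod_rpow_eq_of_moment_eq hA hw hu hv huv hz]

/-- Uniqueness in Birch's theorem, including the boundary. -/
theorem moment_injOn (hA : Nonempty A) (hw : ∀ a, 0 < w a) :
    Set.InjOn moment (normalizedPart w) := by
  intro z hz z' hz' h
  have hs := normalizedPart_subset_stdSimplex hA hw hz
  have hs' := normalizedPart_subset_stdSimplex hA hw hz'
  have hsup : ∀ a, z a = 0 → z' a = 0 := fun a => support_subset_of_moment_eq hA hw hz hz' h
  have hsup' : ∀ a, z' a = 0 → z a = 0 :=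
    fun a => support_subset_of_moment_eq hA hw hz' hz h.symm
  have h1 := sum_mul_log_eq_of_moment_eq hA hw hs hs' h hz (fun _ => id) hsup
  have h2 := sum_mul_log_eq_of_moment_eq hA hw hs hs' h hz' hsup' fun _ => id
  -- The symmetrized relative entropy of `z` and `z'` has non-negative terms, as `log` is
  -- increasing. The relations `h1` and `h2` make its sum zero, so every term vanishes.
  have hterm : ∀ a, 0 ≤ (z a - z' a) * (Real.log (z a / w a) - Real.log (z' a / w a)) := by
    intro a
    rcases (hs.1 a).eq_or_lt with h0 | hpos
    · rw [hsup a h0.symm, ← h0]; simp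
    have hpos' : 0 < z' a := (hs'.1 a).lt_of_ne fun h0 => hpos.ne' (hsup' a h0.symm)
    rcases le_total (z a) (z' a) with hle | hle
    · refine mul_nonneg_of_nonpos_of_nonpos (by linarith) (sub_nonpos.2 ?_)
      exact Real.log_le_log (div_pos hpos (hw a)) (div_le_div_of_nonneg_right hle (hw a).le)
    · refine mul_nonneg (by linarith) (sub_nonneg.2 ?_)
      exact Real.log_le_log (div_pos hpos' (hw a)) (div_le_div_of_nonneg_right hle (hw a).le)
  have hsum : ∑ a, (z a - z' a) * (Real.log (z a / w a) - Real.log (z' a / w a)) = 0 := by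
    simp only [sub_mul, mul_sub, Finset.sum_sub_distrib]
    linarith
  funext a
  have ha := (Finset.sum_eq_zero_iff_of_nonneg fun a _ => hterm a).1 hsum a (Finset.mem_univ a)
  rcases (hs.1 a).eq_or_lt with h0 | hpos
  · rw [hsup a h0.symm, ← h0]
  have hpos' : 0 < z' a := (hs'.1 a).lt_of_ne fun h0 => hpos.ne' (hsup' a h0.symm)
  rcases mul_eq_zero.1 ha with h | h
  · linarith
  · have := Real.log_injOn_pos (div_pos hpos (hw a)) (div_pos hpos' (hw a)) (sub_eq_zero.1 h)
    exact (div_left_inj' (hw a).ne').1 this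

/-- The right side is minimal at `t = 0`, so its derivative vanishes there. Along coordinate
directions this yields the moment equation. -/
theorem sum_mul_eq_zero_of_forall_le {κ : Type*} [Fintype κ] (K c : κ → ℝ)
    (h : ∀ t : ℝ, ∑ a, K a ≤ ∑ a, K a * Real.exp (t * c a)) : ∑ a, K a * c a = 0 := by
  have hderiv : HasDerivAt (fun t : ℝ => ∑ a, K a * Real.exp (t * c a)) (∑ a, K a * c a) 0 := by
    refine HasDerivAt.fun_sum fun a _ => HasDerivAt.const_mul _ ?_
    simpa using ((hasDerivAt_id (0 : ℝ)).mul_const (c a)).exp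
  have hmin : IsLocalMin (fun t : ℝ => ∑ a, K a * Real.exp (t * c a)) 0 :=
    Filter.Eventually.of_forall fun t => by simpa using h t
  exact hmin.hasDerivAt_eq_zero hderiv

/-- A linear form is large at some vertex if the polytope contains a ball. -/
theorem exists_le_sum_mul_sub {r : ℝ} (hr : 0 < r) {y : Fin d → ℝ}
    (hball : Metric.closedBall y r ⊆ domainPolytope (latticePoint A)) (u : Fin d → ℝ) :
    ∃ a : A, r * ‖u‖ ≤ ∑ i, u i * (((a : Fin d → ℤ) i : ℝ) - y i) := by
  by_contra! hlt
  have hsub : domainPolytope (latticePoint A) ⊆ {p | ∑ i, u i * p i < r * ‖u‖ + ∑ i, u i * y i} := by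
    refine convexHull_min ?_ ?_
    · rintro _ ⟨a, rfl⟩
      have := hlt a
      simp only [mul_sub, Finset.sum_sub_distrib] at this
      simp only [Set.mem_ofPred_eq, latticePoint]
      linarith
    · refine convex_halfSpace_lt ⟨fun p q => ?_, fun c p => ?_⟩ _
      · simp [mul_add, Finset.sum_add_distrib]
      · simp only [Pi.smul_apply, smul_eq_mul, Finset.mul_sum]
        exact Finset.sum_congr rfl fun i _ => by ring
  -- This is the point of the sup-norm ball at which the form `u` is largest: it exceeds its value
  -- at `y` by `r ∑ |u i| ≥ r ‖u‖`, which leaves the half-space.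
  have hmem : (fun i => y i + r * SignType.sign (u i) : Fin d → ℝ) ∈ Metric.closedBall y r := by
    rw [mem_closedBall_iff_norm, pi_norm_le_iff_of_nonneg hr.le]
    intro i
    simp only [Pi.sub_apply, add_sub_cancel_left, norm_mul, Real.norm_eq_abs, abs_of_pos hr]
    refine mul_le_of_le_one_right hr.le ?_
    rcases lt_trichotomy (u i) 0 with h | h | h <;> simp [h]
  have := hsub (hball hmem)
  simp only [Set.mem_ofPred_eq, mul_add, Finset.sum_add_distrib] at this
  have h2 : ∑ i, u i * (r * (SignType.sign (u i) : ℝ)) = r * ∑ i, |u i| := by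
    rw [Finset.mul_sum]
    refine Finset.sum_congr rfl fun i _ => ?_
    rw [← self_mul_sign (u i)]
    ring
  have h3 : ‖u‖ ≤ ∑ i, |u i| := by
    rw [pi_norm_le_iff_of_nonneg (Finset.sum_nonneg fun i _ => abs_nonneg _)]
    exact fun i => Finset.single_le_sum (f := fun i => |u i|) (fun i _ => abs_nonneg _)
      (Finset.mem_univ i)
  have h4 := mul_le_mul_of_nonneg_left h3 hr.le
  linarith

/-- Existence in Birch's theorem: a critical point of the coercive function
`u ↦ ∑ w_a exp ⟨u, a - y⟩` solves the moment equation. -/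
theorem exists_torusPoint_moment_eq (hA : Nonempty A) (hw : ∀ a, 0 < w a) {y : Fin d → ℝ}
    (hy : y ∈ interior (domainPolytope (latticePoint A))) :
    ∃ x : Fin d → ℝ, (∀ i, 0 < x i) ∧ moment (torusPoint w x) = y := by
  obtain ⟨r, hr, hball⟩ := Metric.nhds_basis_closedBall.mem_iff.1 (mem_interior_iff_mem_nhds.1 hy)
  set ℓ : (Fin d → ℝ) → A → ℝ := fun u a => ∑ i, u i * (((a : Fin d → ℤ) i : ℝ) - y i) with hℓ
  set Φ : (Fin d → ℝ) → ℝ := fun u => ∑ a, w a * Real.exp (ℓ u a) with hΦ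
  have hΦc : Continuous Φ := by
    simp only [hΦ, hℓ]
    fun_prop
  have hlarge : ∀ u : Fin d → ℝ, ∃ a, r * ‖u‖ ≤ ℓ u a := exists_le_sum_mul_sub hr hball
  obtain ⟨a₀, ha₀⟩ := Finite.exists_min w
  -- Coercivity: some exponent is at least `r ‖u‖`, its weight is at least the smallest weight, and
  -- `exp t ≥ t`.
  have hbound : ∀ u, w a₀ * (r * ‖u‖) ≤ Φ u := by
    intro u
    obtain ⟨a, ha⟩ := hlarge u
    calc w a₀ * (r * ‖u‖) ≤ w a * Real.exp (ℓ u a) := by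
          refine mul_le_mul (ha₀ a) ?_ (by positivity) (hw a).le
          linarith [Real.add_one_le_exp (ℓ u a)]
      _ ≤ Φ u := Finset.single_le_sum (f := fun a => w a * Real.exp (ℓ u a))
          (fun a _ => (mul_pos (hw a) (Real.exp_pos _)).le) (Finset.mem_univ a)
  have htend : Filter.Tendsto Φ (Filter.cocompact _) Filter.atTop :=
    Filter.tendsto_atTop_mono hbound
      (((tendsto_norm_cocompact_atTop).const_mul_atTop hr).const_mul_atTop (hw a₀))
  obtain ⟨u, hu⟩ := hΦc.exists_forall_le htend
  have hpos : ∀ i, 0 < Real.exp (u i) := fun i => Real.exp_pos _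
  refine ⟨fun i => Real.exp (u i), hpos, ?_⟩
  -- With `x = exp u`, the shift by `y` is a factor independent of `a`, so it cancels from the
  -- critical equation.
  have hmon : ∀ a, w a * Real.exp (ℓ u a) =
      monomialVec w (fun i => Real.exp (u i)) a * Real.exp (-∑ i, u i * y i) := by
    intro a
    rw [monomialVec, mul_assoc]
    congr 1
    simp only [hℓ, mul_sub, Finset.sum_sub_distrib]
    rw [sub_eq_add_neg, Real.exp_add, Real.exp_sum]
    congr 1
    refine Finset.prod_congr rfl fun i _ => ?_
    rw [← Real.rpow_intCast, ← Real.exp_mul]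
  funext i
  have hexp : ∀ t : ℝ, Φ (u + Pi.single i t) = ∑ a : A,
      w a * Real.exp (ℓ u a) * Real.exp (t * (((a : Fin d → ℤ) i : ℝ) - y i)) := by
    intro t
    simp only [hΦ]
    refine Finset.sum_congr rfl fun a _ => ?_
    rw [mul_assoc, ← Real.exp_add]
    simp only [hℓ, Pi.add_apply, add_mul, Finset.sum_add_distrib, Pi.single_apply, ite_mul,
      zero_mul, Finset.sum_ite_eq', Finset.mem_univ, if_true]
  have hle : ∀ t : ℝ, ∑ a : A, w a * Real.exp (ℓ u a) ≤ ∑ a : A,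
      w a * Real.exp (ℓ u a) * Real.exp (t * (((a : Fin d → ℤ) i : ℝ) - y i)) := by
    intro t
    rw [← hexp t]
    exact hu _
  have hzero := sum_mul_eq_zero_of_forall_le (fun a => w a * Real.exp (ℓ u a))
    (fun a : A => ((a : Fin d → ℤ) i : ℝ) - y i) hle
  have hF := sum_monomialVec_pos hw hpos
  simp only [hmon] at hzero
  have hzero' : ∑ a : A, monomialVec w (fun i => Real.exp (u i)) a *
      (((a : Fin d → ℤ) i : ℝ) - y i) = 0 := by
    have : Real.exp (-∑ i, u i * y i) * ∑ a : A, monomialVec w (fun i => Real.exp (u i)) a *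
      (((a : Fin d → ℤ) i : ℝ) - y i) = 0 := by
      rw [Finset.mul_sum, ← hzero]
      exact Finset.sum_congr rfl fun a _ => by ring
    exact (mul_eq_zero.1 this).resolve_left (Real.exp_pos _).ne'
  simp only [mul_sub, Finset.sum_sub_distrib, ← Finset.sum_mul] at hzero'
  simp only [moment_apply, torusPoint, div_mul_eq_mul_div, ← Finset.sum_div]
  rw [div_eq_iff hF.ne']
  linarith

/-- The moment map sends the normalized nonnegative part onto the polytope. -/
theorem moment_surjOn (hA : IsPrimitive A) (hw : ∀ a, 0 < w a) :
    Set.SurjOn moment (normalizedPart w) (domainPolytope (latticePoint A)) := by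
  have hclosed : IsClosed (moment '' normalizedPart w) :=
    ((isCompact_normalizedPart hA.nonempty hw).image continuous_moment).isClosed
  -- Torus points reach only interior moments; the boundary is covered because the image of a
  -- compact set is closed.
  rw [Set.SurjOn, ← hA.closure_interior]
  refine closure_minimal (fun y hy => ?_) hclosed
  obtain ⟨x, hx, rfl⟩ := exists_torusPoint_moment_eq hA.nonempty hw hy
  exact ⟨_, torusPoint_mem x hx, rfl⟩

/-- The torus coordinates are Laurent monomials in the normalized coordinates. -/
theorem prod_torusPoint_zpow (hA : Nonempty A) (hw : ∀ a, 0 < w a) {x : Fin d → ℝ}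
    (hx : ∀ i, 0 < x i) {m : A → ℤ} {i : Fin d} (hm : ∑ a, m a = 0)
    (hmi : ∑ a, m a • (a : Fin d → ℤ) = Pi.single i 1) :
    ∏ a, (torusPoint w x a / w a) ^ m a = x i := by
  simp only [torusPoint_div hw hA hx, ← Real.rpow_intCast, ← Real.exp_mul, ← Real.exp_sum, sub_mul,
    Finset.sum_sub_distrib, ← Finset.mul_sum]
  have h0 : ∑ a, (m a : ℝ) = 0 := by exact_mod_cast hm
  have h1 : ∑ a : A, (∑ j, Real.log (x j) * ((a : Fin d → ℤ) j : ℝ)) * (m a : ℝ) = Real.log (x i) := by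
    have hj : ∀ j, ∑ a : A, ((a : Fin d → ℤ) j : ℝ) * (m a : ℝ) = if j = i then 1 else 0 := by
      intro j
      have := congrArg (Int.cast (R := ℝ)) (congrFun hmi j)
      simp only [Finset.sum_apply, Pi.smul_apply, smul_eq_mul, Pi.single_apply] at this
      push_cast at this
      rw [← this]
      exact Finset.sum_congr rfl fun a _ => mul_comm _ _
    simp only [Finset.sum_mul]
    rw [Finset.sum_comm]
    simp only [mul_assoc, ← Finset.mul_sum, hj]
    simp
  rw [h0, h1, mul_zero, sub_zero, Real.exp_log (hx i)]

end Birch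

/-! ### Comparison of closures in projective space and in the simplex. -/

section NonnegativePart

theorem ne_zero_of_mem_stdSimplex {κ : Type*} [Fintype κ] {z : κ → ℝ}
    (hz : z ∈ stdSimplex ℝ κ) : z ≠ 0 := by
  rintro rfl
  simpa using hz.2

theorem eq_of_mk_eq_mk {κ : Type*} [Fintype κ] {z z' : κ → ℝ} (hz : ∑ a, z a = 1)
    (hz' : ∑ a, z' a = 1) {h : z ≠ 0} {h' : z' ≠ 0}
    (heq : Projectivization.mk ℝ z h = Projectivization.mk ℝ z' h') : z = z' := by
  obtain ⟨c, rfl⟩ := (Projectivization.mk_eq_mk_iff' ℝ _ _ h h').1 heq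
  simp only [Pi.smul_apply, smul_eq_mul, ← Finset.mul_sum, hz', mul_one] at hz
  rw [hz, one_smul]

/-- The projective points over a closed subset of the standard simplex form a closed set. -/
theorem isClosed_setOf_mk {κ : Type*} [Fintype κ] {K : Set (κ → ℝ)} (hK : IsClosed K)
    (hKs : K ⊆ stdSimplex ℝ κ) :
    IsClosed[projTopology κ] {P | ∃ z ∈ K, ∃ h : z ≠ 0, P = Projectivization.mk ℝ z h} := by
  rw [isClosed_coinduced]
  -- If `v = c z` with `z` in the simplex, then `∑ v_a = c` and `∑ |v_a| = |c|`, so the factor below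
  -- is `1 / c`. Unlike `1 / ∑ v_a`, it is continuous at every nonzero vector.
  have hset : (fun v : {v : κ → ℝ // v ≠ 0} => Projectivization.mk ℝ (v : κ → ℝ) v.2) ⁻¹'
      {P | ∃ z ∈ K, ∃ h : z ≠ 0, P = Projectivization.mk ℝ z h} =
      {v : {v : κ → ℝ // v ≠ 0} | |∑ a, v.1 a| = ∑ a, |v.1 a| } ∩
        {v : {v : κ → ℝ // v ≠ 0} | ((∑ a, v.1 a) / (∑ a, |v.1 a|) ^ 2) • v.1 ∈ K} := by
    ext ⟨v, hv⟩
    simp only [Set.mem_preimage, Set.mem_ofPred_eq, Set.mem_inter_iff]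
    constructor
    · rintro ⟨z, hz, h, heq⟩
      obtain ⟨c, rfl⟩ := (Projectivization.mk_eq_mk_iff' ℝ _ _ hv h).1 heq
      have hc : c ≠ 0 := by
        rintro rfl
        simp at hv
      have hs : ∑ a, (c • z) a = c := by
        simp [← Finset.mul_sum, (hKs hz).2]
      have hs' : ∑ a, |(c • z) a| = |c| := by
        simp only [Pi.smul_apply, smul_eq_mul, abs_mul, ← Finset.mul_sum,
          abs_of_nonneg ((hKs hz).1 _), (hKs hz).2, mul_one]
      rw [hs, hs', sq_abs, smul_smul, show c / c ^ 2 * c = 1 by field_simp, one_smul]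
      exact ⟨rfl, hz⟩
    · rintro ⟨-, h⟩
      refine ⟨_, h, ne_zero_of_mem_stdSimplex (hKs h), ?_⟩
      refine ((Projectivization.mk_eq_mk_iff' ℝ _ _ _ _).2 ⟨_, rfl⟩).symm
  rw [hset]
  have hne : ∀ v : {v : κ → ℝ // v ≠ 0}, (∑ a, |v.1 a|) ^ 2 ≠ 0 := by
    rintro ⟨v, hv⟩ h
    refine hv (funext fun a => ?_)
    have := (Finset.sum_eq_zero_iff_of_nonneg fun a _ => abs_nonneg (v a)).1
      (pow_eq_zero_iff two_ne_zero |>.1 h) a (Finset.mem_univ a)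
    simpa using this
  have habs : Continuous fun v : {v : κ → ℝ // v ≠ 0} => ∑ a, |v.1 a| :=
    continuous_finsetSum _ fun a _ => ((continuous_apply a).comp continuous_subtype_val).abs
  refine IsClosed.inter (isClosed_eq (by fun_prop) habs) (hK.preimage ?_)
  exact Continuous.smul (Continuous.div (by fun_prop) (habs.pow 2) hne) (by fun_prop)

variable {d : ℕ} {A : Finset (Fin d → ℤ)} {w : A → ℝ}

theorem mk_torusPoint {x : Fin d → ℝ} (h : torusPoint w x ≠ 0) (h' : monomialVec w x ≠ 0) :
    Projectivization.mk ℝ (torusPoint w x) h = Projectivization.mk ℝ (monomialVec w x) h' := by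
  refine (Projectivization.mk_eq_mk_iff' ℝ _ _ _ _).2 ⟨(∑ b, monomialVec w x b)⁻¹, ?_⟩
  funext a
  simp [torusPoint, div_eq_inv_mul]

/-- The projective closure can be computed in the simplex: the points over `normalizedPart w` form a
closed set, and the quotient map is continuous. -/
theorem mem_nonnegPart_iff (hA : Nonempty A) (hw : ∀ a, 0 < w a) (P : ℙ ℝ (A → ℝ)) :
    P ∈ nonnegPart A w ↔ ∃ z ∈ normalizedPart w, ∃ h : z ≠ 0, P = Projectivization.mk ℝ z h := by
  let _ := projTopology A
  constructor
  · intro hP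
    have hclosed := isClosed_setOf_mk isClosed_closure (normalizedPart_subset_stdSimplex hA hw)
    refine closure_minimal ?_ hclosed hP
    rintro _ ⟨x, hx, h, rfl⟩
    have hne := ne_zero_of_mem_stdSimplex
      (normalizedPart_subset_stdSimplex hA hw (torusPoint_mem x hx))
    exact ⟨_, torusPoint_mem x hx, hne, (mk_torusPoint hne h).symm⟩
  · rintro ⟨z, hz, h, rfl⟩
    have hcont : Continuous
        (fun v : {v : A → ℝ // v ≠ 0} => Projectivization.mk ℝ (v : A → ℝ) v.2) :=
      continuous_coinduced_rng
    have hcl : (⟨z, h⟩ : {v : A → ℝ // v ≠ 0}) ∈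
        closure (Subtype.val ⁻¹' (torusPoint w '' {x | ∀ i, 0 < x i})) := by
      rw [closure_subtype]
      refine closure_mono ?_ hz
      rintro _ ⟨x, hx, rfl⟩
      have hne := ne_zero_of_mem_stdSimplex
        (normalizedPart_subset_stdSimplex hA hw (torusPoint_mem x hx))
      exact ⟨⟨_, hne⟩, ⟨x, hx, rfl⟩, rfl⟩
    refine map_mem_closure hcont hcl ?_
    rintro ⟨_, hne⟩ ⟨x, hx, rfl⟩
    have hm : monomialVec w x ≠ 0 := fun h0 =>
      (monomialVec_pos hw hx hA.some).ne' (congrFun h0 _)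
    exact ⟨x, hx, hm, mk_torusPoint hne hm⟩

end NonnegativePart

/-! ### Closure properties of rational functions. -/

section RationalFunctions

variable {d : ℕ} {S : Set (Fin d → ℝ)}

open MvPolynomial

theorem isRationalFunction_const (c : ℝ) : IsRationalFunction (fun _ : S => c) :=
  ⟨C c, 1, one_ne_zero, by simp⟩

theorem IsRationalFunction.mul {g h : S → ℝ} (hg : IsRationalFunction g)
    (hh : IsRationalFunction h) : IsRationalFunction (fun x => g x * h x) := by
  obtain ⟨p, q, hq, hg⟩ := hg
  obtain ⟨r, s, hs, hh⟩ := hh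
  refine ⟨p * r, q * s, mul_ne_zero hq hs, fun x hx => ?_⟩
  rw [eval_mul] at hx
  beta_reduce
  rw [hg x (left_ne_zero_of_mul hx), hh x (right_ne_zero_of_mul hx), eval_mul, eval_mul,
    div_mul_div_comm]

theorem IsRationalFunction.add {g h : S → ℝ} (hg : IsRationalFunction g)
    (hh : IsRationalFunction h) : IsRationalFunction (fun x => g x + h x) := by
  obtain ⟨p, q, hq, hg⟩ := hg
  obtain ⟨r, s, hs, hh⟩ := hh
  refine ⟨p * s + q * r, q * s, mul_ne_zero hq hs, fun x hx => ?_⟩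
  rw [eval_mul] at hx
  beta_reduce
  rw [hg x (left_ne_zero_of_mul hx), hh x (right_ne_zero_of_mul hx), eval_mul, eval_add, eval_mul,
    eval_mul, div_add_div _ _ (left_ne_zero_of_mul hx) (right_ne_zero_of_mul hx)]

theorem IsRationalFunction.inv {g : S → ℝ} (hg : IsRationalFunction g) :
    IsRationalFunction (fun x => (g x)⁻¹) := by
  obtain ⟨p, q, hq, hg⟩ := hg
  rcases eq_or_ne p 0 with rfl | hp
  · exact ⟨0, q, hq, fun x hx => by simp [hg x hx]⟩
  -- The common factor `q` keeps the denominator zero wherever `q` is, so the formula for `g`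
  -- applies at every point under test.
  · refine ⟨q * q, p * q, mul_ne_zero hp hq, fun x hx => ?_⟩
    rw [eval_mul] at hx
    beta_reduce
    rw [hg x (right_ne_zero_of_mul hx), eval_mul, eval_mul, inv_div,
      mul_div_mul_right _ _ (right_ne_zero_of_mul hx)]

theorem IsRationalFunction.prod {κ : Type*} (s : Finset κ) {g : κ → S → ℝ}
    (hg : ∀ a ∈ s, IsRationalFunction (g a)) : IsRationalFunction (fun x => ∏ a ∈ s, g a x) := by
  classical
  induction s using Finset.induction_on with
  | empty => simpa using isRationalFunction_const 1
  | insert a s ha ih =>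
    simp only [Finset.prod_insert ha]
    exact (hg a (Finset.mem_insert_self _ _)).mul
      (ih fun b hb => hg b (Finset.mem_insert_of_mem hb))

theorem IsRationalFunction.sum {κ : Type*} (s : Finset κ) {g : κ → S → ℝ}
    (hg : ∀ a ∈ s, IsRationalFunction (g a)) : IsRationalFunction (fun x => ∑ a ∈ s, g a x) := by
  classical
  induction s using Finset.induction_on with
  | empty => simpa using isRationalFunction_const 0
  | insert a s ha ih =>
    simp only [Finset.sum_insert ha]
    exact (hg a (Finset.mem_insert_self _ _)).add
      (ih fun b hb => hg b (Finset.mem_insert_of_mem hb))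

theorem IsRationalFunction.zpow {g : S → ℝ} (hg : IsRationalFunction g) (n : ℤ) :
    IsRationalFunction (fun x => g x ^ n) := by
  have hpow : ∀ k : ℕ, IsRationalFunction (fun x => g x ^ k) := fun k => by
    simpa using IsRationalFunction.prod (Finset.range k) fun _ _ => hg
  obtain ⟨k, rfl | rfl⟩ := n.eq_nat_or_neg
  · simpa using hpow k
  · simpa using (hpow k).inv

theorem exists_common_denominator {κ : Type*} [Fintype κ] {g : κ → S → ℝ}
    (hg : ∀ i, IsRationalFunction (g i)) :
    ∃ (p : κ → MvPolynomial (Fin d) ℝ) (q : MvPolynomial (Fin d) ℝ), q ≠ 0 ∧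
      ∀ x : S, eval (x : Fin d → ℝ) q ≠ 0 → ∀ i,
        g i x = eval (x : Fin d → ℝ) (p i) / eval (x : Fin d → ℝ) q := by
  classical
  choose p q hq hpq using hg
  refine ⟨fun i => p i * ∏ j ∈ Finset.univ.erase i, q j, ∏ j, q j,
    Finset.prod_ne_zero_iff.2 fun j _ => hq j, fun x hx i => ?_⟩
  rw [← Finset.mul_prod_erase _ q (Finset.mem_univ i), eval_mul] at hx ⊢
  rw [hpq i x (left_ne_zero_of_mul hx), eval_mul, mul_div_mul_right _ _ (right_ne_zero_of_mul hx)]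

/-- A continuous function that is rational on a dense subset is rational. -/
theorem isRationalFunction_of_subset {T : Set (Fin d → ℝ)} (hTS : T ⊆ S) (hS : S ⊆ closure T)
    {g : S → ℝ} (hg : Continuous g)
    (hT : IsRationalFunction (fun x : T => g ⟨x, hTS x.2⟩)) : IsRationalFunction g := by
  obtain ⟨p, q, hq, hpq⟩ := hT
  refine ⟨p, q, hq, fun x hx => ?_⟩
  have hev : ∀ p : MvPolynomial (Fin d) ℝ, Continuous fun x : S => eval (x : Fin d → ℝ) p :=
    fun p => (MvPolynomial.continuous_eval p).comp continuous_subtype_val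
  -- The extra factor `q` makes the equation true at the zeros of `q` as well, so it holds on all of
  -- `T` and passes to the closure.
  have hclosed : IsClosed {x : S | g x * eval (x : Fin d → ℝ) q * eval (x : Fin d → ℝ) q =
      eval (x : Fin d → ℝ) p * eval (x : Fin d → ℝ) q} :=
    isClosed_eq ((hg.mul (hev q)).mul (hev q)) ((hev p).mul (hev q))
  have hdense : Dense {x : S | (x : Fin d → ℝ) ∈ T} := by
    rw [Subtype.dense_iff]
    refine hS.trans (closure_mono fun y hy => ⟨⟨y, hTS hy⟩, hy, rfl⟩)
  have key : g x * eval (x : Fin d → ℝ) q * eval (x : Fin d → ℝ) q =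
      eval (x : Fin d → ℝ) p * eval (x : Fin d → ℝ) q := by
    refine closure_minimal (fun y hy => ?_) hclosed (hdense x)
    by_cases h0 : eval (y : Fin d → ℝ) q = 0
    · simp [h0]
    · have := hpq ⟨y, hy⟩ h0
      simp only at this
      simp only [Set.mem_ofPred_eq]
      rw [this, div_mul_cancel₀ _ h0]
  rw [eq_div_iff hx]
  exact mul_right_cancel₀ hx key

end RationalFunctions

/-! ### Rational linear precision and rational inverses of the moment map. -/

section ToricPatches

open MvPolynomial

variable {d : ℕ} {A : Finset (Fin d → ℤ)} {w : A → ℝ}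

/-- The torus coordinates `x` are rational functions of `∑ w_a x^a a / ∑ w_a x^a`. -/
def HasRationalInverse (w : A → ℝ) : Prop :=
  ∃ (p : Fin d → MvPolynomial (Fin d) ℝ) (q : MvPolynomial (Fin d) ℝ), q ≠ 0 ∧
    ∀ x : Fin d → ℝ, (∀ i, 0 < x i) → eval (moment (torusPoint w x)) q ≠ 0 →
      ∀ i, x i = eval (moment (torusPoint w x)) (p i) / eval (moment (torusPoint w x)) q

theorem Patch.sum_blend_pos {ι : Type*} [Fintype ι] {pt : ι → Fin d → ℝ} (β : Patch pt)
    (x : domainPolytope pt) : 0 < ∑ a, β.blend a x := by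
  refine (Finset.sum_nonneg fun a _ => β.nonneg a x).lt_of_ne fun h => β.no_base_point x ?_
  funext a
  exact (Finset.sum_eq_zero_iff_of_nonneg fun a _ => β.nonneg a x).1 h.symm a (Finset.mem_univ a)

theorem Patch.sum_normalized {ι : Type*} [Fintype ι] {pt : ι → Fin d → ℝ} (β : Patch pt)
    (x : domainPolytope pt) : ∑ a, β.normalized a x = 1 := by
  simp only [Patch.normalized, ← Finset.sum_div]
  exact div_self (β.sum_blend_pos x).ne'

theorem Patch.continuous_normalized {ι : Type*} [Fintype ι] {pt : ι → Fin d → ℝ} (β : Patch pt)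
    (a : ι) : Continuous (β.normalized a) :=
  (β.continuous_blend a).div (continuous_finsetSum _ fun b _ => β.continuous_blend b)
    fun x => (β.sum_blend_pos x).ne'

theorem Patch.normalized_ne_zero {ι : Type*} [Fintype ι] {pt : ι → Fin d → ℝ} (β : Patch pt)
    (x : domainPolytope pt) : (fun a => β.normalized a x) ≠ 0 := by
  intro h
  have := β.sum_normalized x
  simp [show ∀ a, β.normalized a x = 0 from congrFun h] at this

theorem Patch.mk_normalized {ι : Type*} [Fintype ι] {pt : ι → Fin d → ℝ} (β : Patch pt)
    (x : domainPolytope pt) :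
    Projectivization.mk ℝ (fun a => β.normalized a x) (β.normalized_ne_zero x) = β.toProj x := by
  refine (Projectivization.mk_eq_mk_iff' ℝ _ _ _ _).2 ⟨(∑ b, β.blend b x)⁻¹, ?_⟩
  funext a
  simp [Patch.normalized, div_eq_inv_mul]

theorem IsToricPatch.normalized_mem {β : Patch (latticePoint A)} (hβ : IsToricPatch A w β)
    (hA : Nonempty A) (hw : ∀ a, 0 < w a) (x : domainPolytope (latticePoint A)) :
    (fun a => β.normalized a x) ∈ normalizedPart w := by
  have hx : β.toProj x ∈ nonnegPart A w := hβ ▸ ⟨x, rfl⟩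
  obtain ⟨z, hz, h, heq⟩ := (mem_nonnegPart_iff hA hw _).1 hx
  rw [← β.mk_normalized] at heq
  rwa [eq_of_mk_eq_mk (β.sum_normalized x) (normalizedPart_subset_stdSimplex hA hw hz).2 heq]

theorem IsToricPatch.exists_normalized_eq {β : Patch (latticePoint A)} (hβ : IsToricPatch A w β)
    (hA : Nonempty A) (hw : ∀ a, 0 < w a) {z : A → ℝ} (hz : z ∈ normalizedPart w) :
    ∃ x, (fun a => β.normalized a x) = z := by
  have hs := normalizedPart_subset_stdSimplex hA hw hz
  have hP := (mem_nonnegPart_iff hA hw _).2 ⟨z, hz, ne_zero_of_mem_stdSimplex hs, rfl⟩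
  rw [← hβ] at hP
  obtain ⟨x, hx⟩ := hP
  rw [← β.mk_normalized] at hx
  exact ⟨x, eq_of_mk_eq_mk (β.sum_normalized x) hs.2 hx⟩

/-- Uniqueness in Birch's theorem identifies the patch at `ψ y` with the torus point over `y`;
primitivity then recovers `x` from its coordinates by Laurent monomials. -/
theorem IsToricPatch.hasRationalInverse {β : Patch (latticePoint A)} (hβ : IsToricPatch A w β)
    (hA : IsPrimitive A) (hw : ∀ a, 0 < w a) (h : β.HasRationalLinearPrecision) :
    HasRationalInverse w := by
  obtain ⟨-, ψ, hlin, hrat⟩ := h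
  have hne := hA.nonempty
  choose m hm hmi using fun i : Fin d => hA.exists_weights (Pi.single i 1)
  have hX : ∀ i, IsRationalFunction (fun y : domainPolytope (latticePoint A) =>
      ∏ a, (β.normalized a (ψ y) / w a) ^ m i a) := fun i =>
    IsRationalFunction.prod _ fun a _ => IsRationalFunction.zpow
      (by simpa only [div_eq_mul_inv] using (hrat a).mul (isRationalFunction_const (w a)⁻¹)) _
  obtain ⟨p, q, hq, hpq⟩ := exists_common_denominator hX
  refine ⟨p, q, hq, fun x hx hqx i => ?_⟩
  have hmem := torusPoint_mem (w := w) x hx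
  set y : domainPolytope (latticePoint A) := ⟨moment (torusPoint w x),
    moment_mem_domainPolytope (normalizedPart_subset_stdSimplex hne hw hmem)⟩ with hy
  have hz : (fun a => β.normalized a (ψ y)) = torusPoint w x := by
    refine moment_injOn hne hw (hβ.normalized_mem hne hw (ψ y)) hmem (funext fun j => ?_)
    -- Linear precision for the coordinate functions is the statement that the moment equals `y`.
    have := hlin (LinearMap.proj j : (Fin d → ℝ) →ₗ[ℝ] ℝ).toAffineMap y
    simp only [LinearMap.coe_toAffineMap, LinearMap.proj_apply] at this
    rw [moment_apply]
    exact this.symm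
  have hxi := hpq y hqx i
  rw [← prod_torusPoint_zpow hne hw hx (hm i) (hmi i), ← hxi]
  exact Finset.prod_congr rfl fun a _ => by rw [← congrFun hz a]

/-- The tautological map is the parametrization followed by the moment map, a continuous bijection
of the compact `Δ`. Its inverse is the required reparametrization. -/
theorem IsToricPatch.hasRationalLinearPrecision {β : Patch (latticePoint A)}
    (hβ : IsToricPatch A w β) (hA : IsPrimitive A) (hw : ∀ a, 0 < w a)
    (hinj : Function.Injective β.toProj) (h : HasRationalInverse w) :
    β.HasRationalLinearPrecision := by
  have hne := hA.nonempty
  let f : domainPolytope (latticePoint A) → domainPolytope (latticePoint A) := fun x =>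
    ⟨moment fun a => β.normalized a x, moment_mem_domainPolytope
      (normalizedPart_subset_stdSimplex hne hw (hβ.normalized_mem hne hw x))⟩
  have hf : Continuous f := Continuous.subtype_mk
    (continuous_moment.comp (continuous_pi fun a => β.continuous_normalized a)) _
  have hbij : Function.Bijective f := by
    constructor
    · intro x x' hxx
      have hn := moment_injOn hne hw (hβ.normalized_mem hne hw x) (hβ.normalized_mem hne hw x')
        (congrArg Subtype.val hxx)
      refine hinj ?_
      rw [← β.mk_normalized, ← β.mk_normalized]
      exact (Projectivization.mk_eq_mk_iff' ℝ _ _ _ _).2 ⟨1, by rw [one_smul]; exact hn.symm⟩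
    · rintro ⟨y, hy⟩
      obtain ⟨z, hz, rfl⟩ := moment_surjOn hA hw hy
      obtain ⟨x, rfl⟩ := hβ.exists_normalized_eq hne hw hz
      exact ⟨x, rfl⟩
  have : CompactSpace (domainPolytope (latticePoint A)) :=
    isCompact_iff_compactSpace.1 isCompact_domainPolytope
  let τ : domainPolytope (latticePoint A) ≃ₜ domainPolytope (latticePoint A) :=
    Continuous.homeoOfEquivCompactToT2 (f := Equiv.ofBijective f hbij) hf
  have hτ : ∀ y, moment (fun a => β.normalized a (τ.symm y)) = y := fun y =>
    congrArg Subtype.val (τ.apply_symm_apply y)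
  refine ⟨⟨τ, fun x => rfl⟩, τ.symm, fun Λ y => ?_, fun a => ?_⟩
  · have key := Finset.univ.map_affineCombination (latticePoint A)
      (fun a => β.normalized a (τ.symm y)) (β.sum_normalized _) Λ
    rw [Finset.affineCombination_eq_linear_combination _ _ _ (β.sum_normalized _),
      Finset.affineCombination_eq_linear_combination _ _ _ (β.sum_normalized _)] at key
    refine Eq.trans ?_ key
    rw [← hτ y]
    rfl
  -- Torus coordinates `x` are available over interior points only; continuity extends the rational
  -- formula to the boundary.
  · refine isRationalFunction_of_subset (T := interior (domainPolytope (latticePoint A)))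
      interior_subset hA.closure_interior.ge ((β.continuous_normalized a).comp τ.symm.continuous) ?_
    choose X hXpos hX using fun y : interior (domainPolytope (latticePoint A)) =>
      exists_torusPoint_moment_eq hne hw y.2
    have hn : ∀ y : interior (domainPolytope (latticePoint A)),
        (fun a => β.normalized a (τ.symm ⟨y, interior_subset y.2⟩)) = torusPoint w (X y) :=
      fun y => moment_injOn hne hw (hβ.normalized_mem hne hw _) (torusPoint_mem _ (hXpos y))
        ((hτ ⟨y, interior_subset y.2⟩).trans (hX y).symm)
    simp only [fun y => congrFun (hn y) a, torusPoint, monomialVec,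
      div_eq_mul_inv]
    obtain ⟨p, q, hq, hpq⟩ := h
    have hXrat : ∀ i, IsRationalFunction fun y => X y i := fun i =>
      ⟨p i, q, hq, fun y hy => by
        have := hpq (X y) (hXpos y)
        rw [hX y] at this
        exact this hy i⟩
    have hmon : ∀ a : A, IsRationalFunction fun y => w a * ∏ i, X y i ^ (a : Fin d → ℤ) i :=
      fun a => (isRationalFunction_const _).mul
        (IsRationalFunction.prod _ fun i _ => (hXrat i).zpow _)
    exact (hmon a).mul (IsRationalFunction.sum _ fun b _ => hmon b).inv

/-- The inverse of the moment map is a toric patch. -/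
theorem exists_injective_toricPatch (hA : IsPrimitive A) (hw : ∀ a, 0 < w a) :
    ∃ β : Patch (latticePoint A), IsToricPatch A w β ∧ Function.Injective β.toProj := by
  have hne := hA.nonempty
  have hsub := normalizedPart_subset_stdSimplex hne hw
  let f : normalizedPart w → domainPolytope (latticePoint A) := fun z =>
    ⟨moment z.1, moment_mem_domainPolytope (hsub z.2)⟩
  have hf : Continuous f := (continuous_moment.comp continuous_subtype_val).subtype_mk _
  have hbij : Function.Bijective f := by
    refine ⟨fun z z' h => Subtype.ext
      (moment_injOn hne hw z.2 z'.2 (congrArg Subtype.val h)), ?_⟩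
    rintro ⟨y, hy⟩
    obtain ⟨z, hz, rfl⟩ := moment_surjOn hA hw hy
    exact ⟨⟨z, hz⟩, rfl⟩
  have : CompactSpace (normalizedPart w) :=
    isCompact_iff_compactSpace.1 (isCompact_normalizedPart hne hw)
  let μ : normalizedPart w ≃ₜ domainPolytope (latticePoint A) :=
    Continuous.homeoOfEquivCompactToT2 (f := Equiv.ofBijective f hbij) hf
  let β : Patch (latticePoint A) :=
    { blend := fun a y => (μ.symm y).1 a
      continuous_blend := fun a =>
        (continuous_apply a).comp (continuous_subtype_val.comp μ.symm.continuous)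
      nonneg := fun a y => (hsub (μ.symm y).2).1 a
      no_base_point := fun y => ne_zero_of_mem_stdSimplex (hsub (μ.symm y).2) }
  refine ⟨β, ?_, fun y y' h => ?_⟩
  · refine Set.Subset.antisymm ?_ fun P hP => ?_
    · rintro _ ⟨y, rfl⟩
      exact (mem_nonnegPart_iff hne hw _).2 ⟨_, (μ.symm y).2, β.no_base_point y, rfl⟩
    · obtain ⟨z, hz, h, rfl⟩ := (mem_nonnegPart_iff hne hw _).1 hP
      refine ⟨μ ⟨z, hz⟩, ?_⟩
      refine (Projectivization.mk_eq_mk_iff' ℝ _ _ _ _).2 ⟨1, ?_⟩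
      simp [β]
  · exact μ.symm.injective (Subtype.ext
      (eq_of_mk_eq_mk (hsub (μ.symm y).2).2 (hsub (μ.symm y').2).2 h))

end ToricPatches

/-! ### Complex polynomials at real points, and homogenization. -/

section Polynomials

open MvPolynomial

/-- A real vector, regarded as a complex one. -/
def complexify {σ : Type*} (v : σ → ℝ) : σ → ℂ := fun i => (v i : ℂ)

@[simp]
theorem complexify_apply {σ : Type*} (v : σ → ℝ) (i : σ) : complexify v i = (v i : ℂ) := rfl

theorem eval_bind₁ {σ τ R : Type*} [CommSemiring R] (v : τ → R) (f : σ → MvPolynomial τ R)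
    (p : MvPolynomial σ R) : eval v (bind₁ f p) = eval (fun i => eval v (f i)) p :=
  eval₂Hom_bind₁ (RingHom.id R) v f p

/-- A complex polynomial that vanishes at the real points of a nonempty open set is zero. -/
theorem eq_zero_of_eval_complexify {σ : Type*} [Finite σ] {U : Set (σ → ℝ)} (hU : IsOpen U)
    (hne : U.Nonempty) {p : MvPolynomial σ ℂ} (h : ∀ v ∈ U, eval (complexify v) p = 0) :
    p = 0 := by
  obtain ⟨v, hv⟩ := hne
  obtain ⟨u, hu, hsub⟩ := isOpen_pi_iff'.1 hU v hv
  refine funext_set (fun i => (fun t : ℝ => (t : ℂ)) '' u i) (fun i => ?_) fun x hx => ?_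
  · exact (infinite_of_mem_nhds (v i) ((hu i).1.mem_nhds (hu i).2)).image
      Complex.ofReal_injective.injOn
  · choose y hy hyx using fun i => hx i trivial
    rw [map_zero, ← show complexify y = x from funext hyx]
    exact h y (hsub fun i _ => hy i)

theorem exists_eval_complexify_ne_zero {σ : Type*} [Finite σ] {U : Set (σ → ℝ)} (hU : IsOpen U)
    (hne : U.Nonempty) {p : MvPolynomial σ ℂ} (hp : p ≠ 0) :
    ∃ v ∈ U, eval (complexify v) p ≠ 0 := by
  by_contra! h
  exact hp (eq_zero_of_eval_complexify hU hne h)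

theorem eval_complexify_map {σ : Type*} (y : σ → ℝ) (p : MvPolynomial σ ℝ) :
    eval (complexify y) (map Complex.ofRealHom p) = (eval y p : ℂ) := by
  rw [eval_map]
  exact (eval₂_comp_left Complex.ofRealHom (RingHom.id ℝ) y p).symm

/-- A complex polynomial has a real and an imaginary part. -/
theorem exists_re_im {σ : Type*} (p : MvPolynomial σ ℂ) :
    ∃ a b : MvPolynomial σ ℝ, ∀ y : σ → ℝ,
      eval (complexify y) p = (eval y a : ℂ) + Complex.I * (eval y b : ℂ) := by
  induction p using MvPolynomial.induction_on with
  | C c => exact ⟨C c.re, C c.im, fun y => by simp [mul_comm Complex.I]⟩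
  | add p q hp hq =>
    obtain ⟨a, b, h⟩ := hp
    obtain ⟨a', b', h'⟩ := hq
    refine ⟨a + a', b + b', fun y => ?_⟩
    rw [eval_add, h, h', eval_add, eval_add]
    push_cast
    ring
  | mul_X p i hp =>
    obtain ⟨a, b, h⟩ := hp
    refine ⟨a * X i, b * X i, fun y => ?_⟩
    rw [eval_mul, h, eval_mul, eval_mul, eval_X, eval_X, complexify_apply]
    push_cast
    ring

variable {d : ℕ}

/-- The representative of a point of affine space with coordinate sum `N`. -/
def liftPoint (N : ℤ) (y : Fin d → ℝ) : Fin (d + 1) → ℝ := Fin.cons (N - ∑ i, y i) y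

theorem sum_liftPoint (N : ℤ) (y : Fin d → ℝ) : ∑ i, liftPoint N y i = N := by
  simp [liftPoint, Fin.sum_univ_succ]

theorem complexify_liftPoint_ne_zero {N : ℤ} (hN : N ≠ 0) (y : Fin d → ℝ) :
    complexify (liftPoint N y) ≠ 0 := by
  intro h
  refine hN ?_
  have h0 : ∀ i, liftPoint N y i = 0 := fun i => Complex.ofReal_injective (congrFun h i)
  have := sum_liftPoint N y
  simp only [h0, Finset.sum_const_zero] at this
  exact_mod_cast this.symm

/-- Homogenization with respect to the linear form `∑ v_i / N`. -/
theorem exists_homogeneous (N : ℤ) (r : MvPolynomial (Fin d) ℝ) {D : ℕ} (hD : r.totalDegree ≤ D) :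
    ∃ R : MvPolynomial (Fin (d + 1)) ℂ, R.IsHomogeneous D ∧
      ∀ y : Fin d → ℝ, eval (complexify (liftPoint N y)) R = (N : ℂ) ^ D * (eval y r : ℂ) := by
  have hdeg : ∀ m ∈ r.support, ∑ i, m i ≤ D := fun m hm => by
    have := le_totalDegree hm
    rw [Finsupp.sum_fintype _ _ fun _ => rfl] at this
    exact this.trans hD
  -- The form `∑ X_j` has the value `N` on lifted points, so a term of degree `|m|` acquires `N ^ (D
  -- - |m|)`; the coefficient supplies the missing `N ^ |m|`.
  refine ⟨∑ m ∈ r.support, C (((r.coeff m : ℝ) : ℂ) * (N : ℂ) ^ (∑ i, m i)) *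
    ((∏ i : Fin d, X i.succ ^ m i) * (∑ j, X j) ^ (D - ∑ i, m i)), ?_, fun y => ?_⟩
  · refine IsHomogeneous.sum _ _ _ fun m hm => ?_
    have h1 : (∏ i : Fin d, (X i.succ : MvPolynomial (Fin (d + 1)) ℂ) ^ m i).IsHomogeneous
        (∑ i, m i) := IsHomogeneous.prod _ _ _ fun i _ => by
      simpa using (isHomogeneous_X ℂ i.succ).pow (m i)
    have h2 : ((∑ j, X j : MvPolynomial (Fin (d + 1)) ℂ) ^ (D - ∑ i, m i)).IsHomogeneous
        (D - ∑ i, m i) := by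
      simpa using (IsHomogeneous.sum Finset.univ _ 1 fun j _ => isHomogeneous_X ℂ j).pow _
    have h3 := (isHomogeneous_C (Fin (d + 1)) (((r.coeff m : ℝ) : ℂ) * (N : ℂ) ^ (∑ i, m i))).mul
      (h1.mul h2)
    rwa [zero_add, Nat.add_sub_cancel' (hdeg m hm)] at h3
  · have hsum : ∑ j, (liftPoint N y j : ℂ) = N := by exact_mod_cast sum_liftPoint N y
    rw [eval_eq' y r, Complex.ofReal_sum, Finset.mul_sum, map_sum]
    refine Finset.sum_congr rfl fun m hm => ?_
    simp only [eval_mul, eval_C, map_prod, map_pow, eval_X, map_sum, complexify_apply, hsum]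
    simp only [liftPoint, Fin.cons_succ]
    rw [← Nat.add_sub_cancel' (hdeg m hm), pow_add, Nat.add_sub_cancel_left]
    push_cast
    ring

end Polynomials

/-! ### Testing inverses of rational maps at real points. -/

section RationalMaps

open MvPolynomial

namespace RationalMap

variable {n m : ℕ}

/-- Changing a representative scales the values by a power of a nonzero constant, so composites can
be computed on vectors. -/
theorem comp_defined {φ : RationalMap n m} {ψ : RationalMap m n} {P Q R}
    (hQ : Q ∈ φ.toPart P) (hR : R ∈ ψ.toPart Q) :
    ∃ h : ψ.evalVec (φ.evalVec P.rep) ≠ 0, R = Projectivization.mk ℂ _ h := by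
  obtain ⟨h, rfl⟩ := hQ
  obtain ⟨h', rfl⟩ := hR
  obtain ⟨c, hc⟩ := Projectivization.exists_smul_eq_mk_rep ℂ _ h
  have key : ψ.evalVec (Projectivization.mk ℂ (φ.evalVec P.rep) h).rep =
      (c : ℂ) ^ ψ.degree • ψ.evalVec (φ.evalVec P.rep) := by
    rw [← hc]
    exact ψ.evalVec_smul (c : ℂ) _
  have hne : ψ.evalVec (φ.evalVec P.rep) ≠ 0 := by
    intro h0
    rw [h0, smul_zero] at key
    exact h' key
  exact ⟨hne, (Projectivization.mk_eq_mk_iff' ℂ _ _ h' hne).2 ⟨_, key.symm⟩⟩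

/-- A relation between the values at generic real points makes `ψ` a left inverse of `φ`. -/
theorem isLeftInverse_of_real {φ : RationalMap n m} {ψ : RationalMap m n}
    {U : Set (Fin (n + 1) → ℝ)} (hU : IsOpen U) (hne : U.Nonempty)
    {q : MvPolynomial (Fin (n + 1)) ℂ} (hq : q ≠ 0)
    (h : ∀ v ∈ U, eval (complexify v) q ≠ 0 → complexify v ≠ 0 ∧ φ.evalVec (complexify v) ≠ 0 ∧
      ∃ c : ℂ, c ≠ 0 ∧ ψ.evalVec (φ.evalVec (complexify v)) = c • complexify v) :
    ψ.IsLeftInverse φ := by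
  constructor
  · obtain ⟨v, hv, hqv⟩ := exists_eval_complexify_ne_zero hU hne hq
    obtain ⟨hv0, hφ, c, hc, hψ⟩ := h v hv hqv
    have hψ0 : ψ.evalVec (φ.evalVec (complexify v)) ≠ 0 := by
      rw [hψ]
      exact smul_ne_zero hc hv0
    exact ⟨_, _, _, φ.mk_mem_toPart _ hv0 hφ, ψ.mk_mem_toPart _ hφ hψ0⟩
  · intro P Q R hQ hR
    obtain ⟨hne', rfl⟩ := comp_defined hQ hR
    -- Proportionality of `ψ (φ v)` and `v` is the vanishing of the 2 × 2 minors. Times `q` they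
    -- vanish on a real open set, hence identically, and `q` cancels; so they vanish at all complex
    -- points.
    have hpoly : ∀ i j, bind₁ φ.coord (ψ.coord i) * X j - bind₁ φ.coord (ψ.coord j) * X i = 0 := by
      intro i j
      refine (mul_eq_zero.1 (eq_zero_of_eval_complexify hU hne (p := q * _)
        fun v hv => ?_)).resolve_left hq
      rw [eval_mul]
      by_cases hqv : eval (complexify v) q = 0
      · rw [hqv, zero_mul]
      obtain ⟨-, -, c, -, hψ⟩ := h v hv hqv
      have hi : ∀ i, eval (complexify v) (bind₁ φ.coord (ψ.coord i)) = c * v i := fun i => by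
        rw [eval_bind₁]
        exact congrFun hψ i
      rw [eval_sub, eval_mul, eval_mul, eval_X, eval_X, hi, hi, complexify_apply, complexify_apply]
      ring
    have hrel : ∀ i j, ψ.evalVec (φ.evalVec P.rep) i * P.rep j =
        ψ.evalVec (φ.evalVec P.rep) j * P.rep i := by
      intro i j
      have := congrArg (eval P.rep) (hpoly i j)
      rw [eval_sub, eval_mul, eval_mul, eval_X, eval_X, eval_bind₁, eval_bind₁, map_zero,
        sub_eq_zero] at this
      exact this
    obtain ⟨i, hi⟩ := Function.ne_iff.1 P.rep_nonzero
    conv_rhs => rw [← P.mk_rep]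
    refine (Projectivization.mk_eq_mk_iff' ℂ _ _ _ _).2
      ⟨ψ.evalVec (φ.evalVec P.rep) i / P.rep i, funext fun j => ?_⟩
    rw [Pi.smul_apply, smul_eq_mul, div_mul_eq_mul_div, hrel, mul_div_cancel_right₀ _ hi]

theorem IsLeftInverse.exists_smul {φ : RationalMap n m} {ψ : RationalMap m n}
    (h : ψ.IsLeftInverse φ) {v : Fin (n + 1) → ℂ} (hv : v ≠ 0) (hφ : φ.evalVec v ≠ 0)
    (hψ : ψ.evalVec (φ.evalVec v) ≠ 0) :
    ∃ c : ℂ, c ≠ 0 ∧ ψ.evalVec (φ.evalVec v) = c • v := by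
  have := h.2 _ _ _ (φ.mk_mem_toPart v hv hφ) (ψ.mk_mem_toPart _ hφ hψ)
  obtain ⟨c, hc⟩ := (Projectivization.mk_eq_mk_iff' ℂ _ _ _ _).1 this
  refine ⟨c, ?_, hc.symm⟩
  rintro rfl
  exact hψ (by rw [← hc, zero_smul])

end RationalMap

end RationalMaps

/-! ### The toric differential as the moment map in homogeneous coordinates. -/

section ToricDifferential

open MvPolynomial

/-- Evaluation of a Laurent polynomial at a point of the torus. -/
def laurentEval {σ : Type*} [Fintype σ] (v : σ → ℂ) (hv : ∀ i, v i ≠ 0) : Laurent σ →ₐ[ℂ] ℂ :=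
  AddMonoidAlgebra.lift ℂ ℂ (σ → ℤ)
    { toFun := fun a => ∏ i, v i ^ (Multiplicative.toAdd a i)
      map_one' := by simp
      map_mul' := fun a b => by simp [zpow_add₀ (hv _), Finset.prod_mul_distrib] }

theorem laurentEval_monomial {σ : Type*} [Fintype σ] (v : σ → ℂ) (hv : ∀ i, v i ≠ 0)
    (a : σ → ℤ) (c : ℂ) : laurentEval v hv (Laurent.monomial a c) = c * ∏ i, v i ^ a i := by
  simp [laurentEval, Laurent.monomial, AddMonoidAlgebra.lift_single]

theorem laurentEval_toLaurent {σ : Type*} [Fintype σ] [DecidableEq σ] (v : σ → ℂ)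
    (hv : ∀ i, v i ≠ 0) (p : MvPolynomial σ ℂ) :
    laurentEval v hv (toLaurent p) = eval v p := by
  rw [← coe_aeval_eq_eval]
  refine congrFun (congrArg DFunLike.coe
    (show (laurentEval v hv).comp toLaurent = aeval v from algHom_ext fun i => ?_)) p
  simp [toLaurent, Laurent.X, laurentEval_monomial, Pi.single_apply]

theorem zpow_sum_eq_prod {K κ : Type*} [Field K] [Fintype κ] {t : K} (ht : t ≠ 0) (a : κ → ℤ) :
    t ^ (∑ j, a j) = ∏ j, t ^ a j := by
  classical
  induction (Finset.univ : Finset κ) using Finset.induction_on with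
  | empty => simp
  | insert j s hj ih => rw [Finset.sum_insert hj, Finset.prod_insert hj, zpow_add₀ ht, ih]

theorem toLaurent_monomial {σ : Type*} [Fintype σ] [DecidableEq σ] (s : σ →₀ ℕ) (c : ℂ) :
    toLaurent (monomial s c) = Laurent.monomial (fun i => (s i : ℤ)) c := by
  rw [toLaurent, aeval_monomial, Finsupp.prod_fintype _ _ fun _ => pow_zero _]
  simp only [Laurent.X, Laurent.monomial, AddMonoidAlgebra.single_pow, one_pow,
    AddMonoidAlgebra.prod_single, Finset.prod_const_one, AddMonoidAlgebra.coe_algebraMap,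
    Function.comp_apply, Algebra.algebraMap_self, RingHom.id_apply,
    AddMonoidAlgebra.single_mul_single, zero_add, mul_one]
  congr 1
  funext i
  simp [Finset.sum_apply, Pi.single_apply]

/-- The operator `x_i ∂/∂x_i` is diagonal on monomials, with the exponent of `x_i` as eigenvalue. -/
theorem Laurent.X_mul_pderiv_sum {σ κ : Type*} [DecidableEq σ] [Fintype κ] (i : σ)
    (b : κ → σ → ℤ) (c : κ → ℂ) :
    Laurent.X i * Laurent.pderiv i (∑ k, Laurent.monomial (b k) (c k)) =
      ∑ k, Laurent.monomial (b k) ((b k i : ℂ) * c k) := by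
  rw [Laurent.pderiv, AddMonoidAlgebra.coeff_sum, ← Finsupp.sum_finsetSum_index, Finset.mul_sum]
  · refine Finset.sum_congr rfl fun k _ => ?_
    simp only [Laurent.monomial, Laurent.X, AddMonoidAlgebra.coeff_single]
    rw [Finsupp.sum_single_index (by simp), AddMonoidAlgebra.single_mul_single, one_mul,
      add_sub_cancel]
  · simp [Laurent.monomial]
  · simp [Laurent.monomial, mul_add]

variable {d : ℕ} {A : Finset (Fin d → ℤ)} {w : A → ℝ}

theorem toricDifferential_homogenize (N : ℤ) (i : Fin (d + 1)) :
    toricDifferential (homogenize N (shapePolynomial A w)) i =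
      ∑ a : A, Laurent.monomial
        (Fin.cons (N - ∑ j, (a : Fin d → ℤ) j) (a : Fin d → ℤ) : Fin (d + 1) → ℤ)
        (((Fin.cons (N - ∑ j, (a : Fin d → ℤ) j) (a : Fin d → ℤ) : Fin (d + 1) → ℤ) i : ℂ)
          * (w a : ℂ)) := by
  have hF : homogenize N (shapePolynomial A w) = ∑ a : A, Laurent.monomial
      (Fin.cons (N - ∑ j, (a : Fin d → ℤ) j) (a : Fin d → ℤ) : Fin (d + 1) → ℤ) (w a : ℂ) := by
    rw [homogenize, shapePolynomial, AddMonoidAlgebra.coeff_sum, ← Finsupp.sum_finsetSum_index]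
    · refine Finset.sum_congr rfl fun a _ => ?_
      simp only [Laurent.monomial, AddMonoidAlgebra.coeff_single]
      rw [Finsupp.sum_single_index (by simp)]
    · simp [Laurent.monomial]
    · simp [Laurent.monomial]
  rw [toricDifferential, hF, Laurent.X_mul_pderiv_sum]

/-- At a positive point, the toric differential is proportional to the lift of the moment map. -/
theorem exists_eval_eq_smul_liftPoint (hA : Nonempty A) (hw : ∀ a, 0 < w a) {N : ℤ}
    {f : Fin (d + 1) → MvPolynomial (Fin (d + 1)) ℂ} {e : Fin (d + 1) → ℤ}
    (hf : ∀ i, toLaurent (f i) =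
      Laurent.monomial e 1 * toricDifferential (homogenize N (shapePolynomial A w)) i)
    {v : Fin (d + 1) → ℝ} (hv : ∀ i, 0 < v i) :
    ∃ c : ℂ, c ≠ 0 ∧ (fun i => eval (complexify v) (f i)) =
      c • complexify (liftPoint N (moment (torusPoint w fun i => v i.succ / v 0))) := by
  set x : Fin d → ℝ := fun i => v i.succ / v 0 with hxdef
  have hx : ∀ i, 0 < x i := fun i => div_pos (hv _) (hv _)
  have hvC : ∀ i, complexify v i ≠ 0 := fun i => Complex.ofReal_ne_zero.2 (hv i).ne'
  have hF := sum_monomialVec_pos hw hx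
  have h0 := hv 0
  -- The scalar is the value at `v` of the denominator-clearing monomial times `F(v) = v_0 ^ N
  -- f(x)`.
  refine ⟨(∏ i, complexify v i ^ e i) * ((v 0 ^ N * ∑ a, monomialVec w x a : ℝ) : ℂ),
    mul_ne_zero (Finset.prod_ne_zero_iff.2 fun i _ => zpow_ne_zero _ (hvC i))
      (Complex.ofReal_ne_zero.2 (mul_pos (zpow_pos h0 N) hF).ne'), funext fun i => ?_⟩
  have hprod : ∀ a : Fin d → ℤ,
      ∏ j, v j ^ (Fin.cons (N - ∑ j, a j) a : Fin (d + 1) → ℤ) j = v 0 ^ N * ∏ j, x j ^ a j := by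
    intro a
    rw [Fin.prod_univ_succ]
    simp only [Fin.cons_zero, Fin.cons_succ, hxdef, div_zpow, Finset.prod_div_distrib]
    have hpow : v 0 ^ (∑ j, a j) = ∏ j, v 0 ^ a j :=
      zpow_sum_eq_prod h0.ne' a
    rw [zpow_sub₀ h0.ne', hpow]
    field_simp
  -- The weighted mean of the exponent vectors `(N - |a|, a)` is the lift of the moment.
  have hlift : ∀ i, (∑ a, monomialVec w x a) * liftPoint N (moment (torusPoint w x)) i =
      ∑ a : A, monomialVec w x a *
        ((Fin.cons (N - ∑ j, (a : Fin d → ℤ) j) (a : Fin d → ℤ) : Fin (d + 1) → ℤ) i : ℝ) := by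
    have hsucc : ∀ j, (∑ a, monomialVec w x a) * moment (torusPoint w x) j =
        ∑ a : A, monomialVec w x a * ((a : Fin d → ℤ) j : ℝ) := by
      intro j
      simp only [moment_apply, torusPoint, div_mul_eq_mul_div, ← Finset.sum_div]
      exact mul_div_cancel₀ _ hF.ne'
    refine Fin.cases ?_ fun j => ?_
    · simp only [liftPoint, Fin.cons_zero, mul_sub, Finset.mul_sum, hsucc]
      push_cast
      rw [Finset.sum_comm]
      simp only [mul_sub, Finset.sum_sub_distrib, Finset.mul_sum, Finset.sum_mul]
    · simpa [liftPoint] using hsucc j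
  have key := congrArg (laurentEval (complexify v) hvC) (hf i)
  rw [laurentEval_toLaurent, map_mul, laurentEval_monomial, one_mul,
    toricDifferential_homogenize, map_sum] at key
  rw [key, Pi.smul_apply, smul_eq_mul, mul_assoc]
  congr 1
  rw [complexify_apply, ← Complex.ofReal_mul, mul_assoc, hlift, Finset.mul_sum, Complex.ofReal_sum]
  refine Finset.sum_congr rfl fun a _ => ?_
  rw [laurentEval_monomial]
  have := congrArg (fun t : ℝ => (t : ℂ)) (hprod a)
  simp only [Complex.ofReal_prod, Complex.ofReal_zpow, Complex.ofReal_mul] at this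
  simp only [complexify_apply]
  rw [this, monomialVec]
  push_cast
  ring

/-- Multiplication by a monomial turns the toric differential into a rational map. -/
theorem exists_isGivenBy (hA : Nonempty A) (hw : ∀ a, 0 < w a) {N : ℤ} (hN : N ≠ 0) :
    ∃ φ : RationalMap d d,
      φ.IsGivenBy (toricDifferential (homogenize N (shapePolynomial A w))) := by
  set b : A → Fin (d + 1) → ℤ := fun a =>
    Fin.cons (N - ∑ j, (a : Fin d → ℤ) j) (a : Fin d → ℤ) with hb
  -- Multiplying by `(x_0 ⋯ x_d) ^ M` makes all exponents non-negative and all degrees equal to `(d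
  -- + 1) M + N`.
  set M : ℤ := ∑ a, ∑ j, |b a j| with hM
  have hnonneg : ∀ a j, 0 ≤ M + b a j := by
    intro a j
    have h1 : |b a j| ≤ ∑ j, |b a j| :=
      Finset.single_le_sum (f := fun j => |b a j|) (fun _ _ => abs_nonneg _) (Finset.mem_univ j)
    have h2 : ∑ j, |b a j| ≤ M :=
      Finset.single_le_sum (f := fun a => ∑ j, |b a j|)
        (fun _ _ => Finset.sum_nonneg fun _ _ => abs_nonneg _) (Finset.mem_univ a)
    linarith [neg_abs_le (b a j)]
  set s : A → Fin (d + 1) →₀ ℕ := fun a =>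
    Finsupp.equivFunOnFinite.symm fun j => (M + b a j).toNat with hs
  have hsb : ∀ a j, ((s a j : ℕ) : ℤ) = M + b a j := fun a j => by
    simp [hs, Int.toNat_of_nonneg (hnonneg a j)]
  have hdeg : ∀ a, (s a).degree = ((d + 1) * M + N).toNat := by
    intro a
    zify
    have hsum : ∑ j, ((s a j : ℕ) : ℤ) = (d + 1) * M + N := by
      simp only [hsb, Finset.sum_add_distrib]
      simp [hb, Fin.sum_univ_succ]
    rw [Finsupp.degree_eq_sum, ← hsum, Int.toNat_of_nonneg
      (Finset.sum_nonneg fun j _ => Int.natCast_nonneg _), Nat.cast_sum]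
  set f : Fin (d + 1) → MvPolynomial (Fin (d + 1)) ℂ := fun i =>
    ∑ a, monomial (s a) ((b a i : ℂ) * (w a : ℂ)) with hfdef
  have hf : ∀ i, toLaurent (f i) = Laurent.monomial (fun _ => M) 1 *
      toricDifferential (homogenize N (shapePolynomial A w)) i := by
    intro i
    rw [toricDifferential_homogenize, hfdef, map_sum, Finset.mul_sum]
    refine Finset.sum_congr rfl fun a _ => ?_
    rw [toLaurent_monomial]
    simp only [Laurent.monomial, AddMonoidAlgebra.single_mul_single, one_mul]
    congr 1
    exact funext fun j => hsb a j
  refine ⟨⟨_, f, fun i => IsHomogeneous.sum _ _ _ fun a _ =>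
    isHomogeneous_monomial _ (hdeg a), fun h0 => ?_⟩, fun _ => M, hf⟩
  obtain ⟨c, hc, heq⟩ := exists_eval_eq_smul_liftPoint hA hw hf (v := fun _ => 1)
    fun _ => one_pos
  refine smul_ne_zero hc (complexify_liftPoint_ne_zero hN _) (heq.symm.trans ?_)
  simp [h0]
  rfl

/-- If the toric differential has a rational inverse, then so has the moment map. -/
theorem hasRationalInverse_of_isBirational (hA : Nonempty A) (hw : ∀ a, 0 < w a) {N : ℤ}
    (hN : N ≠ 0)
    (h : DefinesBirational (toricDifferential (homogenize N (shapePolynomial A w)))) :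
    HasRationalInverse w := by
  obtain ⟨φ, ⟨e, he⟩, ψ, hψφ, -⟩ := h
  have hφ := fun {v : Fin (d + 1) → ℝ} (hv : ∀ i, 0 < v i) =>
    exists_eval_eq_smul_liftPoint hA hw he hv
  -- The inverse map restricted to the chart of vectors `(N - ∑ y_j, y)`.
  set r : Fin (d + 1) → MvPolynomial (Fin d) ℂ := fun i =>
    bind₁ (Fin.cons (C (N : ℂ) - ∑ j, X j) X) (ψ.coord i) with hr
  have hreval : ∀ (y : Fin d → ℝ) i,
      eval (complexify y) (r i) = ψ.evalVec (complexify (liftPoint N y)) i := by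
    intro y i
    rw [hr, eval_bind₁, RationalMap.evalVec]
    congr 2
    funext j
    refine Fin.cases ?_ (fun j => ?_) j <;> simp [liftPoint]
  have hcomp : ∀ {v : Fin (d + 1) → ℝ}, (∀ i, 0 < v i) → complexify v ≠ 0 ∧
      φ.evalVec (complexify v) ≠ 0 ∧ ∃ c : ℂ, c ≠ 0 ∧ ∀ i,
        ψ.evalVec (φ.evalVec (complexify v)) i =
          c * eval (complexify (moment (torusPoint w fun i => v i.succ / v 0))) (r i) := by
    intro v hv
    obtain ⟨c, hc, heq⟩ := hφ hv
    have heq' : φ.evalVec (complexify v) = _ := heq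
    refine ⟨fun h0 => (hv 0).ne' (Complex.ofReal_injective (congrFun h0 0)), ?_,
      c ^ ψ.degree, pow_ne_zero _ hc, fun i => ?_⟩
    · rw [heq']
      exact smul_ne_zero hc (complexify_liftPoint_ne_zero hN _)
    · rw [heq', ψ.evalVec_smul, hreval]
      rfl
  -- The composite is nonzero at some positive real vector, where it is a multiple of that vector,
  -- whose zeroth coordinate is not zero.
  have hr0 : ∃ y : Fin d → ℝ, eval (complexify y) (r 0) ≠ 0 := by
    obtain ⟨P, Q, R, hQ, hR⟩ := hψφ.1
    obtain ⟨hne, -⟩ := RationalMap.comp_defined hQ hR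
    obtain ⟨i, hi⟩ := Function.ne_iff.1 hne
    have hpoly : bind₁ φ.coord (ψ.coord i) ≠ 0 := by
      intro h0
      refine hi ?_
      have := congrArg (eval P.rep) h0
      rwa [eval_bind₁, map_zero] at this
    obtain ⟨v, hv, hvi⟩ := exists_eval_complexify_ne_zero
      (isOpen_set_pi (Set.toFinite Set.univ) fun (_ : Fin (d + 1)) _ => isOpen_Ioi (a := (0 : ℝ)))
      ⟨fun _ => 1, fun _ _ => one_pos (α := ℝ)⟩ hpoly
    have hv' : ∀ i, 0 < v i := fun i => hv i trivial
    obtain ⟨hv0, hφv, c, hc, hcv⟩ := hcomp hv'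
    have hψv : ψ.evalVec (φ.evalVec (complexify v)) ≠ 0 := by
      intro h0
      rw [eval_bind₁] at hvi
      exact hvi (congrFun h0 i)
    obtain ⟨c', hc', hcv'⟩ := hψφ.exists_smul hv0 hφv hψv
    refine ⟨moment (torusPoint w fun i => v i.succ / v 0), fun h0 => ?_⟩
    have h1 := hcv 0
    rw [h0, mul_zero, hcv'] at h1
    exact mul_ne_zero hc' (Complex.ofReal_ne_zero.2 (hv' 0).ne') h1
  choose a b hab using fun i => exists_re_im (r i)
  -- From `r_0 x_i = r_i` with `x_i` real, multiplying by the conjugate of `r_0` and taking real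
  -- parts gives `x_i = (a_0 a_i + b_0 b_i) / (a_0 ^ 2 + b_0 ^ 2)`.
  refine ⟨fun i => a 0 * a i.succ + b 0 * b i.succ, a 0 * a 0 + b 0 * b 0, ?_, ?_⟩
  · obtain ⟨y, hy⟩ := hr0
    intro h0
    have := congrArg (eval y) h0
    simp only [eval_add, eval_mul, map_zero] at this
    refine hy ?_
    rw [hab, (mul_self_add_mul_self_eq_zero.1 this).1, (mul_self_add_mul_self_eq_zero.1 this).2]
    simp
  · intro x hx hq i
    set y := moment (torusPoint w x) with hy
    have hr0y : eval (complexify y) (r 0) ≠ 0 := by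
      intro h0
      refine hq ?_
      rw [hab] at h0
      have h1 : eval y (a 0) = 0 := by simpa using congrArg Complex.re h0
      have h2 : eval y (b 0) = 0 := by simpa using congrArg Complex.im h0
      simp [h1, h2]
    set v : Fin (d + 1) → ℝ := Fin.cons 1 x with hvdef
    have hv : ∀ i, 0 < v i := Fin.cases (by simp [hvdef]) fun i => by simpa [hvdef] using hx i
    obtain ⟨hv0, hφv, c, hc, hcv⟩ := hcomp hv
    simp only [hvdef, Fin.cons_succ, Fin.cons_zero, div_one] at hcv
    rw [← hy, ← hvdef] at hcv
    have hψv : ψ.evalVec (φ.evalVec (complexify v)) ≠ 0 := fun h0 => by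
      have := hcv 0
      rw [h0] at this
      exact mul_ne_zero hc hr0y this.symm
    obtain ⟨c', hc', hcv'⟩ := hψφ.exists_smul hv0 hφv hψv
    have e0 : c' = c * eval (complexify y) (r 0) := by
      rw [← hcv, hcv']
      simp [hvdef]
    have ei : c' * x i = c * eval (complexify y) (r i.succ) := by
      rw [← hcv, hcv']
      simp [hvdef]
    have hxi : eval (complexify y) (r 0) * x i = eval (complexify y) (r i.succ) := by
      refine mul_left_cancel₀ hc ?_
      rw [← ei, e0, mul_assoc]
    rw [hab, hab] at hxi
    have h1 : eval y (a 0) * x i = eval y (a i.succ) := by simpa using congrArg Complex.re hxi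
    have h2 : eval y (b 0) * x i = eval y (b i.succ) := by simpa using congrArg Complex.im hxi
    rw [eq_div_iff hq]
    simp only [eval_add, eval_mul, ← h1, ← h2]
    ring

/-- If the moment map has a rational inverse, then so has the toric differential. -/
theorem definesBirational_of_hasRationalInverse (hA : IsPrimitive A) (hw : ∀ a, 0 < w a) {N : ℤ}
    (hN : N ≠ 0) (h : HasRationalInverse w) :
    DefinesBirational (toricDifferential (homogenize N (shapePolynomial A w))) := by
  have hne := hA.nonempty
  have hNC : (N : ℂ) ≠ 0 := Int.cast_ne_zero.2 hN
  obtain ⟨p, q, hq, hpq⟩ := h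
  obtain ⟨φ, hφG⟩ := exists_isGivenBy (A := A) hne hw hN
  obtain ⟨e, he⟩ := id hφG
  have hφ : ∀ {v : Fin (d + 1) → ℝ}, (∀ i, 0 < v i) → ∃ c : ℂ, c ≠ 0 ∧ φ.evalVec (complexify v) =
      c • complexify (liftPoint N (moment (torusPoint w fun i => v i.succ / v 0))) := fun hv =>
    exists_eval_eq_smul_liftPoint hne hw he hv
  -- The candidate inverse is `y ↦ [q : p_1 : … : p_d]`, homogenized in a common degree; the sum `D`
  -- bounds every degree.
  set g : Fin (d + 1) → MvPolynomial (Fin d) ℝ := Fin.cons q p with hg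
  set D : ℕ := ∑ i, (g i).totalDegree with hD
  choose R hRhom hReval using fun i => exists_homogeneous N (g i)
    (Finset.single_le_sum (f := fun i => (g i).totalDegree) (fun _ _ => Nat.zero_le _)
      (Finset.mem_univ i) : (g i).totalDegree ≤ D)
  obtain ⟨y₀, hy₀, hqy₀⟩ : ∃ y ∈ interior (domainPolytope (latticePoint A)), eval y q ≠ 0 := by
    obtain ⟨y, hy, hqy⟩ := exists_eval_complexify_ne_zero isOpen_interior hA.interior_nonempty
      (p := map Complex.ofRealHom q)
      fun h0 => hq (map_injective _ Complex.ofReal_injective (h0.trans (map_zero _).symm))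
    rw [eval_complexify_map] at hqy
    exact ⟨y, hy, fun h0 => hqy (by rw [h0, Complex.ofReal_zero])⟩
  have hR0 : ∀ y, eval (complexify (liftPoint N y)) (R 0) = (N : ℂ) ^ D * (eval y q : ℂ) :=
    fun y => hReval 0 y
  have hR0ne : R 0 ≠ 0 := by
    intro h0
    have := hR0 y₀
    rw [h0, map_zero] at this
    exact mul_ne_zero (pow_ne_zero _ hNC) (Complex.ofReal_ne_zero.2 hqy₀) this.symm
  let ψ : RationalMap d d := ⟨D, R, hRhom, fun h0 => hR0ne (congrFun h0 0)⟩
  have hψ : ∀ x : Fin d → ℝ, (∀ i, 0 < x i) → eval (moment (torusPoint w x)) q ≠ 0 →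
      ψ.evalVec (complexify (liftPoint N (moment (torusPoint w x)))) =
        ((N : ℂ) ^ D * (eval (moment (torusPoint w x)) q : ℂ)) •
          complexify (Fin.cons 1 x : Fin (d + 1) → ℝ) := by
    intro x hx hqx
    funext i
    refine Eq.trans (hReval i _) ?_
    rw [Pi.smul_apply, smul_eq_mul, mul_assoc, complexify_apply, ← Complex.ofReal_mul]
    congr 2
    refine Fin.cases ?_ (fun j => ?_) i
    · simp [hg]
    · have := hpq x hx hqx j
      rw [eq_div_iff hqx, mul_comm] at this
      simpa [hg] using this.symm
  refine ⟨φ, hφG, ψ, ?_, ?_⟩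
  -- For `ψ ∘ φ`, test on the positive orthant away from the zeros of `R 0 ∘ φ`.
  · refine RationalMap.isLeftInverse_of_real (q := bind₁ φ.coord (R 0))
      (isOpen_set_pi (Set.toFinite Set.univ) fun (_ : Fin (d + 1)) _ => isOpen_Ioi (a := (0 : ℝ)))
      ⟨fun _ => 1, fun _ _ => one_pos (α := ℝ)⟩ (fun h0 => ?_) fun v hv hqv => ?_
    · obtain ⟨x, hx, rfl⟩ := exists_torusPoint_moment_eq hne hw hy₀
      have hv : ∀ i, 0 < (Fin.cons 1 x : Fin (d + 1) → ℝ) i :=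
        Fin.cases (by simp) fun i => by simpa using hx i
      obtain ⟨c, hc, heq⟩ := hφ hv
      simp only [Fin.cons_succ, Fin.cons_zero, div_one] at heq
      have h1 := congrArg (eval (complexify (Fin.cons 1 x : Fin (d + 1) → ℝ))) h0
      rw [eval_bind₁, map_zero] at h1
      have h2 : ψ.evalVec (φ.evalVec (complexify (Fin.cons 1 x : Fin (d + 1) → ℝ))) 0 = 0 := h1
      rw [heq, ψ.evalVec_smul, hψ x hx hqy₀] at h2
      simp only [Pi.smul_apply, smul_eq_mul, complexify_apply, Fin.cons_zero, Complex.ofReal_one, mul_one] at h2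
      exact mul_ne_zero (pow_ne_zero _ hc)
        (mul_ne_zero (pow_ne_zero _ hNC) (Complex.ofReal_ne_zero.2 hqy₀)) h2
    · have hv' : ∀ i, 0 < v i := fun i => hv i trivial
      have hv0 : complexify v ≠ 0 := fun h0 =>
        (hv' 0).ne' (Complex.ofReal_injective (congrFun h0 0))
      obtain ⟨c, hc, heq⟩ := hφ hv'
      set x : Fin d → ℝ := fun i => v i.succ / v 0 with hxdef
      have hx : ∀ i, 0 < x i := fun i => div_pos (hv' _) (hv' _)
      have hqx : eval (moment (torusPoint w x)) q ≠ 0 := by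
        intro h0
        refine hqv ?_
        rw [eval_bind₁]
        change ψ.evalVec (φ.evalVec (complexify v)) 0 = 0
        rw [heq, ψ.evalVec_smul]
        change _ * eval (complexify (liftPoint N _)) (R 0) = 0
        rw [hR0, h0]
        simp
      refine ⟨hv0, heq ▸ smul_ne_zero hc (complexify_liftPoint_ne_zero hN _), ?_⟩
      have hv00 : (v 0 : ℂ) ≠ 0 := Complex.ofReal_ne_zero.2 (hv' 0).ne'
      refine ⟨c ^ D * ((N : ℂ) ^ D * (eval (moment (torusPoint w x)) q : ℂ)) / v 0,
        div_ne_zero (mul_ne_zero (pow_ne_zero _ hc)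
          (mul_ne_zero (pow_ne_zero _ hNC) (Complex.ofReal_ne_zero.2 hqx))) hv00, ?_⟩
      rw [heq, ψ.evalVec_smul, hψ x hx hqx, smul_smul, div_eq_mul_inv, mul_smul _ (_)⁻¹]
      congr 1
      funext i
      refine Fin.cases ?_ (fun j => ?_) i
      · simp [hv00]
      · simp [hxdef, div_eq_inv_mul]
  · have hsc : Continuous fun v : Fin (d + 1) → ℝ => ∑ i, v i := by fun_prop
    -- For `φ ∘ ψ`, a vector of nonzero coordinate sum is rescaled to the lift of an affine point.
    -- Where that point is interior to `Δ`, Birch's theorem writes it as the moment of a torus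
    -- point.
    set Y : (Fin (d + 1) → ℝ) → Fin d → ℝ := fun v j => N * v j.succ / ∑ i, v i with hY
    have hYlift : ∀ v : Fin (d + 1) → ℝ, ∑ i, v i ≠ 0 →
        complexify v = (((∑ i, v i) / N : ℝ) : ℂ) • complexify (liftPoint N (Y v)) := by
      intro v hs
      have hNR : (N : ℝ) ≠ 0 := Int.cast_ne_zero.2 hN
      have hvi : ∀ i, v i = (∑ i, v i) / N * liftPoint N (Y v) i := by
        refine Fin.cases ?_ fun j => ?_
        · have hsum : ∑ j, Y v j = N * (∑ i, v i - v 0) / ∑ i, v i := by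
            rw [Fin.sum_univ_succ, add_sub_cancel_left, ← Fin.sum_univ_succ, Finset.mul_sum,
              Finset.sum_div]
          simp only [liftPoint, Fin.cons_zero]
          rw [hsum]
          field_simp
          ring
        · simp only [liftPoint, Fin.cons_succ, hY]
          field_simp
      funext i
      rw [Pi.smul_apply, smul_eq_mul, complexify_apply, complexify_apply, ← Complex.ofReal_mul,
        ← hvi i]
    have hopen : IsOpen ({v : Fin (d + 1) → ℝ | ∑ i, v i ≠ 0} ∩
        Y ⁻¹' interior (domainPolytope (latticePoint A))) := by
      refine ContinuousOn.isOpen_inter_preimage ?_ (isOpen_ne_fun hsc continuous_const)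
        isOpen_interior
      exact continuousOn_pi.2 fun j => ContinuousOn.div (by fun_prop) hsc.continuousOn
        fun v hv => hv
    refine RationalMap.isLeftInverse_of_real (q := R 0) hopen ⟨liftPoint N y₀, ?_, ?_⟩ hR0ne
      fun v hv hqv => ?_
    · simpa [sum_liftPoint] using hN
    · have hNR : (N : ℝ) ≠ 0 := Int.cast_ne_zero.2 hN
      have : Y (liftPoint N y₀) = y₀ := by
        funext j
        simp only [hY, sum_liftPoint]
        simp [liftPoint, hNR]
      rw [Set.mem_preimage, this]
      exact hy₀
    · obtain ⟨hs, hYv⟩ := hv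
      obtain ⟨x, hx, hxY⟩ := exists_torusPoint_moment_eq hne hw hYv
      set k : ℂ := (((∑ i, v i) / N : ℝ) : ℂ) with hk
      have hk0 : k ≠ 0 :=
        Complex.ofReal_ne_zero.2 (div_ne_zero hs (Int.cast_ne_zero.2 hN))
      have hvk := hYlift v hs
      rw [← hk, ← hxY] at hvk
      have hψv := ψ.evalVec_smul k (complexify (liftPoint N (moment (torusPoint w x))))
      rw [← hvk] at hψv
      have hqx : eval (moment (torusPoint w x)) q ≠ 0 := by
        intro h0
        refine hqv ?_
        have := congrFun hψv 0
        refine this.trans ?_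
        change _ * eval (complexify (liftPoint N _)) (R 0) = 0
        rw [hR0, h0]
        simp
      rw [hψ x hx hqx, smul_smul] at hψv
      set l : ℂ := k ^ ψ.degree * ((N : ℂ) ^ D * (eval (moment (torusPoint w x)) q : ℂ)) with hl
      have hl0 : l ≠ 0 := mul_ne_zero (pow_ne_zero _ hk0)
        (mul_ne_zero (pow_ne_zero _ hNC) (Complex.ofReal_ne_zero.2 hqx))
      have hv1 : ∀ i, 0 < (Fin.cons 1 x : Fin (d + 1) → ℝ) i :=
        Fin.cases (by simp) fun i => by simpa using hx i
      obtain ⟨c, hc, heq⟩ := hφ hv1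
      simp only [Fin.cons_succ, Fin.cons_zero, div_one] at heq
      refine ⟨?_, ?_, l ^ φ.degree * c * k⁻¹, mul_ne_zero (mul_ne_zero (pow_ne_zero _ hl0) hc)
        (inv_ne_zero hk0), ?_⟩
      · rw [hvk]
        exact smul_ne_zero hk0 (complexify_liftPoint_ne_zero hN _)
      · rw [hψv]
        refine smul_ne_zero hl0 fun h0 => ?_
        simpa using congrFun h0 0
      · rw [hψv, φ.evalVec_smul, heq, hvk, smul_smul, smul_smul, mul_assoc _ k⁻¹ k,
          inv_mul_cancel₀ hk0, mul_one]

end ToricDifferential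

end

end ToricPatch

/-! ### The two equivalences. -/

/-- The first part speaks about the shape `(𝒜, w)`, that is, about toric patches up to
reparametrization; the second about each single toric patch of this shape whose parametrization
`Δ → X_{𝒜,w}` is one-to-one. -/
theorem corollary3p8 {d : ℕ} (A : Finset (Fin d → ℤ)) (hA : ToricPatch.IsPrimitive A)
    (w : A → ℝ) (hw : ∀ a, 0 < w a) (N : ℤ) (hN : N ≠ 0) :
    ((∃ β : ToricPatch.Patch (ToricPatch.latticePoint A),
          ToricPatch.IsToricPatch A w β ∧ β.HasRationalLinearPrecision) ↔
        ToricPatch.DefinesBirational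
          (ToricPatch.toricDifferential
            (ToricPatch.homogenize N (ToricPatch.shapePolynomial A w)))) ∧
      ∀ β : ToricPatch.Patch (ToricPatch.latticePoint A),
        ToricPatch.IsToricPatch A w β → Function.Injective β.toProj →
          (β.HasRationalLinearPrecision ↔
            ToricPatch.DefinesBirational
              (ToricPatch.toricDifferential
                (ToricPatch.homogenize N (ToricPatch.shapePolynomial A w)))) := by
  have hto : ∀ β : ToricPatch.Patch (ToricPatch.latticePoint A), ToricPatch.IsToricPatch A w β →
      β.HasRationalLinearPrecision → ToricPatch.DefinesBirational
        (ToricPatch.toricDifferential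
          (ToricPatch.homogenize N (ToricPatch.shapePolynomial A w))) := fun β hβ h =>
    ToricPatch.definesBirational_of_hasRationalInverse hA hw hN (hβ.hasRationalInverse hA hw h)
  have hfrom : ∀ β : ToricPatch.Patch (ToricPatch.latticePoint A), ToricPatch.IsToricPatch A w β →
      Function.Injective β.toProj → ToricPatch.DefinesBirational
        (ToricPatch.toricDifferential
          (ToricPatch.homogenize N (ToricPatch.shapePolynomial A w))) →
      β.HasRationalLinearPrecision := fun β hβ hinj h =>
    hβ.hasRationalLinearPrecision hA hw hinj
      (ToricPatch.hasRationalInverse_of_isBirational hA.nonempty hw hN h)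
  refine ⟨⟨fun ⟨β, hβ, h⟩ => hto β hβ h, fun h => ?_⟩,
    fun β hβ hinj => ⟨hto β hβ, hfrom β hβ hinj⟩⟩
  -- The shape always has an injective toric patch, the inverse of the moment map, to which the
  -- second part applies.
  obtain ⟨β, hβ, hinj⟩ := ToricPatch.exists_injective_toricPatch hA hw
  exact ⟨β, hβ, hfrom β hβ hinj h⟩
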